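/- Let $n\ge 2$ be an integer and let $A=\{a_1,\dots,a_n\}$ be a set of exactly $n$ integers with $0=a_1<a_2<\dots<a_n$. An *$A$-expansion* of an integer $k\ge 0$ is a tuple $(\alpha_0,\dots,\alpha_J)$ of elements of $A$ with $\alpha_J\neq 0$ and $k=\sum_{j=0}^{J}\alpha_j n^j$ (the empty tuple being the expansion of $0$). The *$n$-ary tree* $\mathcal T$ has real numbers as vertices: its root is $0$, the children of the root are $\frac kn$ for $k=1,\dots,n-1$, and every other vertex $\alpha$ has the children $\frac{\alpha+k}{n}$ for $k=0,\dots,n-1$. A set of vertices of $\mathcal T$ is a *minimal cut set* if every infinite path without backtracking that starts at the root (the root itself not being counted as a point of the path) has exactly one vertex in common with it. There is exactly one compactly supported tempered distribution $\varphi$ on $\mathbb R$ with $$\varphi(t)=\sum_{i=1}^{n}\varphi(nt-a_i)\qquad\text{and}\qquad \langle\varphi,1\rangle=1 ,$$ and for this $\varphi$ the following three assertions are equivalent: (a) every integer $k\ge 0$ has at most one $A$-expansion; (b) $\varphi\in L_1(\mathbb R)$; (c) $\mathcal T$ has a minimal cut set all of whose elements are roots of the trigonometric polynomial $\boldsymbol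 c(t)=\frac1n\sum_{k=1}^{n}e^{-2\pi i a_k t}$. -/

import Mathlib

open MeasureTheory Topology
open scoped SchwartzMap

noncomputable section

namespace NumberSystem

/-- `l = [α₀, …, α_J]` is an `A`-expansion of `k` in base `n`: all `α_j` lie in `A`,
`k = ∑ α_j n ^ j`, and the leading digit `α_J` is nonzero (the empty list expands `0`). -/
def IsExpansion (n : ℕ) (A : Finset ℕ) (k : ℕ) (l : List ℕ) : Prop :=
  (∀ d ∈ l, d ∈ A) ∧ (∀ h : l ≠ [], l.getLast h ≠ 0) ∧ Nat.ofDigits n l = k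

/-- Every natural number has at most one `A`-expansion in base `n`. -/
def HasUniqueExpansions (n : ℕ) (A : Finset ℕ) : Prop :=
  ∀ (k : ℕ) (l l' : List ℕ), IsExpansion n A k l → IsExpansion n A k l' → l = l'

/-- The mask `c(t) = (1/n) ∑_{a ∈ A} exp (-2πi a t)`. -/
def mask (n : ℕ) (A : Finset ℕ) (t : ℝ) : ℂ :=
  (1 / (n : ℂ)) * ∑ a ∈ A, Complex.exp (-2 * Real.pi * Complex.I * (a : ℂ) * (t : ℂ))

/-! ### The `n`-ary tree -/

/-- `β` is a child of `α` in the `n`-ary tree, whose vertices are real numbers (distinct vertices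
being distinct numbers): the root `0` has the children `k / n`, `1 ≤ k ≤ n - 1`, and every other
vertex `α` has the children `(α + k) / n`, `0 ≤ k ≤ n - 1`. -/
def IsChild (n : ℕ) (α β : ℝ) : Prop :=
  (α = 0 ∧ ∃ k : ℕ, 1 ≤ k ∧ k < n ∧ β = k / n) ∨
    (α ≠ 0 ∧ ∃ k : ℕ, k < n ∧ β = (α + k) / n)

/-- The vertices of the `n`-ary tree: the descendants of the root `0`, the root included. -/
def treeVertices (n : ℕ) : Set ℝ := {α | Relation.ReflTransGen (IsChild n) 0 α}

/-- `v 0, v 1, v 2, …` is an infinite path without backtracking starting at the root `v 0 = 0`. -/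
def IsPath (n : ℕ) (v : ℕ → ℝ) : Prop :=
  v 0 = 0 ∧ ∀ j, IsChild n (v j) (v (j + 1))

/-- A minimal cut set: a set of vertices such that every infinite path from the root (the root
itself not counted as a point of the path) has exactly one vertex in common with it. -/
def IsMinimalCutSet (n : ℕ) (C : Set ℝ) : Prop :=
  C ⊆ treeVertices n ∧ ∀ v : ℕ → ℝ, IsPath n v → ∃! x : ℝ, x ∈ C ∧ ∃ j : ℕ, v (j + 1) = x

/-! ### The refinement equation in tempered distributions -/

/-- The Schwartz function `x ↦ g ((x + s) / r)`, as a continuous linear map in `g`. -/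
def schwartzAffine (r : ℝ) (hr : r ≠ 0) (s : ℝ) : 𝓢(ℝ, ℂ) →L[ℂ] 𝓢(ℝ, ℂ) :=
  (SchwartzMap.compSubConstCLM ℂ (-s)).comp
    (SchwartzMap.compCLMOfContinuousLinearEquiv ℂ
      (ContinuousLinearEquiv.smulLeft (Units.mk0 r hr)⁻¹))

theorem schwartzAffine_apply (r : ℝ) (hr : r ≠ 0) (s : ℝ) (g : 𝓢(ℝ, ℂ)) (x : ℝ) :
    schwartzAffine r hr s g x = g ((x + s) / r) := by
  change g (r⁻¹ * (x - -s)) = _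
  rw [sub_neg_eq_add, div_eq_inv_mul]

/-- The tempered distribution `f (r t - s)`, that is `g ↦ |r|⁻¹ ⟨f, g ((· + s) / r)⟩`. -/
def distAffine (r : ℝ) (hr : r ≠ 0) (s : ℝ) (f : 𝓢'(ℝ, ℂ)) : 𝓢'(ℝ, ℂ) :=
  ((|r|⁻¹ : ℝ) : ℂ) • PointwiseConvergenceCLM.precomp ℂ (schwartzAffine r hr s) f

theorem distAffine_apply (r : ℝ) (hr : r ≠ 0) (s : ℝ) (f : 𝓢'(ℝ, ℂ)) (g : 𝓢(ℝ, ℂ)) :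
    distAffine r hr s f g = ((|r|⁻¹ : ℝ) : ℂ) * f (schwartzAffine r hr s g) := rfl

/-- The transition operator `[T f](t) = ∑_{a ∈ A} f (n t - a)` on tempered distributions. -/
def transition (n : ℕ) (hn : n ≠ 0) (A : Finset ℕ) (f : 𝓢'(ℝ, ℂ)) : 𝓢'(ℝ, ℂ) :=
  ∑ a ∈ A, distAffine (n : ℝ) (Nat.cast_ne_zero.mpr hn) (a : ℝ) f

/-- The distribution `f` is supported in the set `K`. -/
def SupportedIn (f : 𝓢'(ℝ, ℂ)) (K : Set ℝ) : Prop := Distribution.IsVanishingOn f Kᶜ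

/-- `φ` is the compactly supported tempered distribution that solves the refinement equation
`φ(t) = ∑_{a ∈ A} φ (n t - a)` and is normalized by `⟨φ, 1⟩ = 1`. As usual, the pairing of `φ` with
the constant `1` is its pairing with any test function equal to `1` near the support. -/
structure IsRefinable (n : ℕ) (hn : n ≠ 0) (A : Finset ℕ) (φ : 𝓢'(ℝ, ℂ)) : Prop where
  compact_support : ∃ K : Set ℝ, IsCompact K ∧ SupportedIn φ K
  refinement : transition n hn A φ = φ
  normalized : ∀ K : Set ℝ, IsCompact K → SupportedIn φ K →
    ∀ χ : 𝓢(ℝ, ℂ), (∀ᶠ x in 𝓝ˢ K, χ x = 1) → φ χ = 1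

/-- The tempered distribution `φ` belongs to `L₁(ℝ)`. -/
def MemL1 (φ : 𝓢'(ℝ, ℂ)) : Prop :=
  ∃ f : Lp ℂ 1 (volume : Measure ℝ), MeasureTheory.Lp.toTemperedDistribution f = φ

end NumberSystem

end

/-! The solution is a probability measure `μ`: the law of `∑ ω_j n^(-j-1)` with independent digits
`ω_j` uniform on `A`. It lives on the compact set `T` of all values of this series. The adjoint of
the transition operator, `averaging`, preserves `μ`-integrals and divides derivatives by `n`. Its
iterates on a test function `g` therefore flatten to the constant `∫ g dμ`, so every normalized
solution is `μ` (`IsRefinable.apply_eq_integral`).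

Unique expansions make the `n^J` digit sums of length `J` distinct integers. At scale `n^(-J)`, `μ`
then has at most the density of the integers, and `J → ∞` gives `μ ≤ volume`. A single coincidence
instead covers `T` by fewer than `n^J` copies scaled by `n^(-J)`, so `T` is null and carries no
nonzero `L₁` function.

For the tree, the transform of `μ` factors as `∏ c(t / n^j)`, and `c` is 1 on the integers, so its
value at `k` recurs at every `n^m k`. If `μ` is integrable, Riemann–Lebesgue makes it vanish at each
`k ≠ 0`, whence some `c(k / n^j) = 0`. Modulo 1 these points form the tree path of `k`, and `c` has
period 1, so paths meet roots of `c`. Conversely, if every path meets a root, the transform vanishes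
at all nonzero integers. Then `μ` projects to Haar measure on `ℝ/ℤ`, which forces absolute
continuity. -/

noncomputable section

namespace NumberSystem

section

open scoped ENNReal

/-! ### The self-similar measure -/

/-- Prepending an independent letter to an i.i.d. sequence gives the same i.i.d. sequence. -/
theorem map_cons_infinitePi {X : Type*} [MeasurableSpace X] (P : Measure X)
    [IsProbabilityMeasure P] :
    (P.prod (Measure.infinitePi fun _ : ℕ ↦ P)).map
      (fun p i ↦ (Nat.casesOn i p.1 p.2 : X)) = Measure.infinitePi fun _ : ℕ ↦ P := by
  classical
  have hm : Measurable (fun (p : X × (ℕ → X)) (i : ℕ) ↦ (Nat.casesOn i p.1 p.2 : X)) := by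
    refine measurable_pi_lambda _ fun i ↦ ?_
    cases i with
    | zero => exact measurable_fst
    | succ i => exact (measurable_pi_apply i).comp measurable_snd
  refine Measure.eq_infinitePi _ fun s t ht ↦ ?_
  obtain ⟨N, hN⟩ : ∃ N, s ⊆ Finset.range (N + 1) :=
    ⟨s.sup id, fun i hi ↦ Finset.mem_range_succ_iff.2 (Finset.le_sup (f := id) hi)⟩
  -- Padding with `univ` turns the cylinder over `s` into one over an initial segment, from which
  -- coordinate 0 splits off.
  set t' : ℕ → Set X := fun i ↦ if i ∈ s then t i else Set.univ with ht'
  have hmeas : ∀ i, MeasurableSet (t' i) := fun i ↦ by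
    by_cases hi : i ∈ s <;> simp [ht', hi, ht i]
  have hpi : Set.pi (s : Set ℕ) t = Set.pi (Finset.range (N + 1) : Set ℕ) t' := by
    ext x
    simp only [Set.mem_pi, Finset.mem_coe, ht']
    constructor
    · intro h i _
      by_cases hi : i ∈ s <;> simp [hi, h i]
    · intro h i hi
      simpa [hi] using h i (hN hi)
  have hprod : ∏ i ∈ s, P (t i) = ∏ i ∈ Finset.range (N + 1), P (t' i) := by
    rw [← Finset.prod_subset hN]
    · exact Finset.prod_congr rfl fun i hi ↦ by simp [ht', hi]
    · intro i _ hi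
      simp [ht', hi]
  rw [hpi, hprod, Finset.prod_range_succ', Measure.map_apply hm
    (MeasurableSet.pi (Finset.countable_toSet _) fun i _ ↦ hmeas i)]
  have hpre : (fun (p : X × (ℕ → X)) (i : ℕ) ↦ (Nat.casesOn i p.1 p.2 : X)) ⁻¹'
      Set.pi (Finset.range (N + 1) : Set ℕ) t' =
      t' 0 ×ˢ Set.pi (Finset.range N : Set ℕ) fun i ↦ t' (i + 1) := by
    ext p
    simp only [Set.mem_preimage, Set.mem_pi, Finset.coe_range, Set.mem_Iio, Set.mem_prod]
    constructor
    · exact fun h ↦ ⟨h 0 (by omega), fun i hi ↦ h (i + 1) (by omega)⟩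
    · rintro ⟨h, h'⟩ i hi
      cases i with
      | zero => exact h
      | succ i => exact h' i (by omega)
  rw [hpre, Measure.prod_prod, Measure.infinitePi_pi _ (fun i _ ↦ hmeas _), mul_comm]

/-- The measure `μ` is the average of its images under the contractions `x ↦ (x + a) / n`. -/
def IsSelfSimilar (n : ℕ) (A : Finset ℕ) (μ : Measure ℝ) : Prop :=
  μ = (n : ℝ≥0∞)⁻¹ • ∑ a ∈ A, μ.map fun x : ℝ ↦ (x + a) / n

/-- Prepending a digit `a` to the random series acts on its value as `x ↦ (x + a) / n`. This gives
both the covering of `T` and the self-similarity of the law. -/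
theorem exists_isSelfSimilar {n : ℕ} (hn : 2 ≤ n) {A : Finset ℕ} (hA : A.card = n) :
    ∃ (μ : Measure ℝ) (T : Set ℝ), IsProbabilityMeasure μ ∧ IsCompact T ∧ μ Tᶜ = 0 ∧
      (T ⊆ ⋃ a ∈ A, (fun x : ℝ ↦ (x + a) / n) '' T) ∧ IsSelfSimilar n A μ := by
  have hn1 : (1 : ℝ) < n := by exact_mod_cast hn
  have hn0 : (n : ℝ) ≠ 0 := by positivity
  have : Nonempty A := by
    rw [Finset.nonempty_coe_sort, ← Finset.card_pos]; omega
  set P : Measure A := (PMF.uniformOfFintype A).toMeasure with hP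
  set Q : Measure (ℕ → A) := Measure.infinitePi fun _ ↦ P
  set X : (ℕ → A) → ℝ := fun ω ↦ ∑' j, (ω j : ℝ) / n ^ (j + 1) with hX
  obtain ⟨M, hM⟩ : ∃ M : ℕ, ∀ a ∈ A, a ≤ M := ⟨A.sup id, fun a ha ↦ Finset.le_sup (f := id) ha⟩
  have hsum : Summable fun j : ℕ ↦ (M : ℝ) / n ^ (j + 1) := by
    have := (summable_geometric_of_lt_one (r := (n : ℝ)⁻¹) (by positivity)
      (inv_lt_one_of_one_lt₀ hn1)).mul_left ((M : ℝ) / n)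
    refine this.congr fun j ↦ ?_
    rw [inv_pow, pow_succ]; field_simp
  have hle : ∀ (j : ℕ) (ω : ℕ → A), ‖(ω j : ℝ) / n ^ (j + 1)‖ ≤ (M : ℝ) / n ^ (j + 1) := by
    intro j ω
    rw [Real.norm_of_nonneg (by positivity)]
    gcongr
    exact_mod_cast hM _ (ω j).2
  have hcont : Continuous X := by
    refine continuous_tsum (fun j ↦ ?_) hsum hle
    exact ((continuous_of_discreteTopology (f := fun a : A ↦ ((a : ℕ) : ℝ))).comp
      (continuous_apply j)).div_const _
  have hstep : ∀ (a : A) (ω : ℕ → A), X (fun i ↦ (Nat.casesOn i a ω : A)) = (X ω + a) / n := by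
    intro a ω
    have hs : ∀ ω : ℕ → A, Summable fun j : ℕ ↦ (ω j : ℝ) / n ^ (j + 1) :=
      fun ω ↦ .of_norm_bounded hsum fun j ↦ hle j ω
    simp only [hX]
    rw [(hs _).tsum_eq_zero_add, add_div, ← tsum_div_const, add_comm]
    congr 1
    · refine tsum_congr fun j ↦ ?_
      rw [pow_succ (n : ℝ) (j + 1), div_div]
    · simp
  have hmeasX : Measurable X := hcont.measurable
  refine ⟨Q.map X, Set.range X, Measure.isProbabilityMeasure_map hmeasX.aemeasurable,
    isCompact_range hcont, ?_, ?_, ?_⟩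
  · rw [Measure.map_apply hmeasX (isCompact_range hcont).measurableSet.compl]
    convert measure_empty (μ := Q)
    ext ω; simp
  · rintro _ ⟨ω, rfl⟩
    refine Set.mem_iUnion₂.2 ⟨ω 0, (ω 0).2, _, ⟨fun i ↦ ω (i + 1), rfl⟩, ?_⟩
    refine (hstep _ _).symm.trans (congrArg X ?_)
    ext i
    cases i <;> rfl
  · have hmc : Measurable (fun (p : A × (ℕ → A)) (i : ℕ) ↦ (Nat.casesOn i p.1 p.2 : A)) := by
      refine measurable_pi_lambda _ fun i ↦ ?_
      cases i with
      | zero => exact measurable_fst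
      | succ i => exact (measurable_pi_apply i).comp measurable_snd
    refine (Measure.ext fun E hE ↦ ?_ : Q.map X = _)
    conv_lhs => rw [show Q = _ from (map_cons_infinitePi P).symm]
    have haff : ∀ a : ℕ, Measurable fun x : ℝ ↦ (x + a) / n := fun a ↦ by fun_prop
    rw [Measure.map_map hmeasX hmc, Measure.map_apply (hmeasX.comp hmc) hE,
      Measure.prod_apply ((hmeasX.comp hmc) hE), lintegral_fintype]
    simp only [Measure.smul_apply, Measure.coe_finsetSum, Finset.sum_apply, smul_eq_mul]
    rw [← Finset.sum_coe_sort A, Finset.mul_sum]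
    refine Finset.sum_congr rfl fun a _ ↦ ?_
    rw [Measure.map_apply (haff a) hE, Measure.map_apply hmeasX (haff a hE), mul_comm]
    congr 1
    · rw [hP, PMF.toMeasure_apply_singleton _ _ (measurableSet_singleton a)]
      simp [hA]
    · congr 1
      ext ω
      simp [hstep]

end

section

open scoped ENNReal ContDiff Manifold

/-! ### The refinable distribution -/

theorem IsSelfSimilar.integral_eq {n : ℕ} {A : Finset ℕ} {μ : Measure ℝ} [IsFiniteMeasure μ]
    (h : IsSelfSimilar n A μ) {g : ℝ → ℂ} (hg : Continuous g) {B : ℝ} (hB : ∀ x, ‖g x‖ ≤ B) :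
    ∫ x, g x ∂μ = (n : ℂ)⁻¹ * ∑ a ∈ A, ∫ x : ℝ, g ((x + a) / n) ∂μ := by
  have haff : ∀ a : ℕ, Measurable fun x : ℝ ↦ (x + a) / n := fun a ↦ by fun_prop
  conv_lhs => rw [show μ = _ from h]
  rw [integral_smul_measure, integral_finsetSum_measure]
  · have : ∀ a ∈ A, ∫ x, g x ∂(μ.map fun x : ℝ ↦ (x + a) / n) =
        ∫ x : ℝ, g ((x + a) / n) ∂μ := fun a _ ↦
      integral_map (haff a).aemeasurable hg.aestronglyMeasurable
    rw [Finset.sum_congr rfl this]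
    simp [Complex.real_smul]
  · intro a _
    exact Integrable.of_bound hg.aestronglyMeasurable B (.of_forall hB)

/-- The adjoint of the transition operator, `[S g](x) = (1/n) ∑_{a ∈ A} g ((x + a) / n)`. -/
def averaging (n : ℕ) (hn : n ≠ 0) (A : Finset ℕ) : 𝓢(ℝ, ℂ) →L[ℂ] 𝓢(ℝ, ℂ) :=
  (n : ℂ)⁻¹ • ∑ a ∈ A, schwartzAffine (n : ℝ) (Nat.cast_ne_zero.mpr hn) (a : ℝ)

theorem averaging_apply (n : ℕ) (hn : n ≠ 0) (A : Finset ℕ) (g : 𝓢(ℝ, ℂ)) (x : ℝ) :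
    averaging n hn A g x = (n : ℂ)⁻¹ * ∑ a ∈ A, g ((x + a) / n) := by
  simp [averaging, schwartzAffine_apply]

theorem transition_apply (n : ℕ) (hn : n ≠ 0) (A : Finset ℕ) (f : 𝓢'(ℝ, ℂ)) (g : 𝓢(ℝ, ℂ)) :
    transition n hn A f g = f (averaging n hn A g) := by
  have : transition n hn A f g =
      ∑ a ∈ A, distAffine (n : ℝ) (Nat.cast_ne_zero.mpr hn) (a : ℝ) f g := by
    simp [transition]
  rw [this]
  simp [distAffine_apply, averaging, Finset.mul_sum]

/-- The chain-rule factor `1/n` is the source of all the contraction in the uniqueness proof. -/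
theorem derivCLM_averaging (n : ℕ) (hn : n ≠ 0) (A : Finset ℕ) (g : 𝓢(ℝ, ℂ)) :
    SchwartzMap.derivCLM ℂ ℂ (averaging n hn A g) =
      (n : ℂ)⁻¹ • averaging n hn A (SchwartzMap.derivCLM ℂ ℂ g) := by
  ext x
  rw [SchwartzMap.derivCLM_apply]
  have hg : ∀ a ∈ A, HasDerivAt (fun x : ℝ ↦ g ((x + a) / n))
      ((n : ℂ)⁻¹ * deriv g ((x + a) / n)) x := by
    intro a _
    have h1 : HasDerivAt (fun x : ℝ ↦ (x + a) / n) (1 / (n : ℝ)) x :=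
      ((hasDerivAt_id x).add_const _).div_const _
    have h2 := HasDerivAt.scomp x (g.hasDerivAt ((x + a) / n)) h1
    simpa [Function.comp_def, Complex.real_smul] using h2
  have h := (HasDerivAt.fun_sum hg).const_mul (n : ℂ)⁻¹
  have he : (averaging n hn A g : ℝ → ℂ) =
      fun x ↦ (n : ℂ)⁻¹ * ∑ a ∈ A, g ((x + a) / n) := funext (averaging_apply n hn A g)
  rw [he, h.deriv]
  simp [averaging_apply, SchwartzMap.derivCLM_apply, Finset.mul_sum]

theorem iterate_derivCLM_iterate_averaging (n : ℕ) (hn : n ≠ 0) (A : Finset ℕ) (j m : ℕ)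
    (g : 𝓢(ℝ, ℂ)) :
    (SchwartzMap.derivCLM ℂ ℂ)^[j] ((averaging n hn A)^[m] g) =
      ((n : ℂ)⁻¹) ^ (m * j) • (averaging n hn A)^[m] ((SchwartzMap.derivCLM ℂ ℂ)^[j] g) := by
  have hsmul : ∀ (m : ℕ) (c : ℂ) (g : 𝓢(ℝ, ℂ)),
      (averaging n hn A)^[m] (c • g) = c • (averaging n hn A)^[m] g := by
    intro m c g
    induction m generalizing g with
    | zero => rfl
    | succ m ih => simp [ih]
  have hone : ∀ (m : ℕ) (g : 𝓢(ℝ, ℂ)),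
      SchwartzMap.derivCLM ℂ ℂ ((averaging n hn A)^[m] g) =
        ((n : ℂ)⁻¹) ^ m • (averaging n hn A)^[m] (SchwartzMap.derivCLM ℂ ℂ g) := by
    intro m g
    induction m generalizing g with
    | zero => simp
    | succ m ih =>
      rw [Function.iterate_succ_apply, ih, derivCLM_averaging, hsmul, smul_smul, ← pow_succ,
        Function.iterate_succ_apply]
  induction j with
  | zero => simp
  | succ j ih =>
    rw [Function.iterate_succ_apply', ih, map_smul, hone, smul_smul, ← pow_add,
      Function.iterate_succ_apply']
    rfl

theorem coe_iterate_derivCLM (j : ℕ) (g : 𝓢(ℝ, ℂ)) :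
    ((SchwartzMap.derivCLM ℂ ℂ)^[j] g : ℝ → ℂ) = iteratedDeriv j g := by
  induction j with
  | zero => simp
  | succ j ih =>
    rw [iteratedDeriv_succ, ← ih, Function.iterate_succ_apply']
    ext x
    exact SchwartzMap.derivCLM_apply _ _ _

theorem exists_norm_iterate_averaging_le {n : ℕ} (hn : n ≠ 0) {A : Finset ℕ} (hA : A.card = n)
    (g : 𝓢(ℝ, ℂ)) : ∃ B : ℝ, 0 ≤ B ∧ ∀ m x, ‖(averaging n hn A)^[m] g x‖ ≤ B := by
  refine ⟨SchwartzMap.seminorm ℝ 0 0 g, apply_nonneg _ _, fun m ↦ ?_⟩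
  induction m with
  | zero => exact fun x ↦ SchwartzMap.norm_le_seminorm ℝ g x
  | succ m ih =>
    intro x
    rw [Function.iterate_succ_apply', averaging_apply, norm_mul, norm_inv, Complex.norm_natCast,
      inv_mul_le_iff₀ (by positivity)]
    refine (norm_sum_le_of_le _ fun a _ ↦ ih _).trans ?_
    simp [hA]

theorem exists_norm_iteratedDeriv_averaging_le {n : ℕ} (hn : n ≠ 0) {A : Finset ℕ}
    (hA : A.card = n) (g : 𝓢(ℝ, ℂ)) {j : ℕ} (hj : j ≠ 0) :
    ∃ B : ℝ, 0 ≤ B ∧ ∀ m x,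
      ‖iteratedDeriv j ((averaging n hn A)^[m] g) x‖ ≤ B * ((n : ℝ)⁻¹) ^ m := by
  obtain ⟨B, hB0, hB⟩ := exists_norm_iterate_averaging_le hn hA ((SchwartzMap.derivCLM ℂ ℂ)^[j] g)
  refine ⟨B, hB0, fun m x ↦ ?_⟩
  rw [← coe_iterate_derivCLM, iterate_derivCLM_iterate_averaging, smul_apply,
    norm_smul, norm_pow, norm_inv, Complex.norm_natCast, mul_comm]
  have h1 : (n : ℝ)⁻¹ ≤ 1 := inv_le_one_of_one_le₀ (by exact_mod_cast Nat.one_le_iff_ne_zero.2 hn)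
  exact mul_le_mul (hB m x) (pow_le_pow_of_le_one (by positivity) h1
    (Nat.le_mul_of_pos_right m (Nat.pos_of_ne_zero hj))) (by positivity) hB0

theorem integral_iterate_averaging {n : ℕ} (hn : n ≠ 0) {A : Finset ℕ} {μ : Measure ℝ}
    [IsProbabilityMeasure μ] (h : IsSelfSimilar n A μ) (g : 𝓢(ℝ, ℂ)) (m : ℕ) :
    ∫ x, (averaging n hn A)^[m] g x ∂μ = ∫ x, g x ∂μ := by
  have hint : ∀ (g : 𝓢(ℝ, ℂ)) (a : ℕ), Integrable (fun x : ℝ ↦ g ((x + a) / n)) μ := fun g a ↦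
    Integrable.of_bound (g.continuous.comp (by fun_prop)).aestronglyMeasurable _
      (.of_forall fun x ↦ SchwartzMap.norm_le_seminorm ℝ g _)
  induction m with
  | zero => rfl
  | succ m ih =>
    rw [Function.iterate_succ_apply', ← ih]
    simp_rw [averaging_apply]
    rw [integral_const_mul, integral_finsetSum _ fun a _ ↦ hint _ a]
    exact (h.integral_eq (SchwartzMap.continuous _)
      fun x ↦ SchwartzMap.norm_le_seminorm ℝ _ x).symm

/-- All derivatives of the iterates `S^m g - ∫ g ∂μ` decay geometrically in `m`, locally uniformly
with linear growth. -/
theorem exists_norm_iteratedFDeriv_averaging_sub_le {n : ℕ} (hn : n ≠ 0) {A : Finset ℕ}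
    (hA : A.card = n) {μ : Measure ℝ} [IsProbabilityMeasure μ] (h : IsSelfSimilar n A μ)
    {T : Set ℝ} (hT : IsCompact T) (hμT : μ Tᶜ = 0) (g : 𝓢(ℝ, ℂ)) (j : ℕ) :
    ∃ C : ℝ, 0 ≤ C ∧ ∀ m x,
      ‖iteratedFDeriv ℝ j (fun x ↦ (averaging n hn A)^[m] g x - ∫ y, g y ∂μ) x‖ ≤
        C * (1 + ‖x‖) * ((n : ℝ)⁻¹) ^ m := by
  rcases eq_or_ne j 0 with rfl | hj
  · obtain ⟨B, hB0, hB⟩ := exists_norm_iteratedDeriv_averaging_le hn hA g one_ne_zero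
    obtain ⟨R, hR⟩ := hT.isBounded.exists_norm_le
    have hae : ∀ᵐ y ∂μ, ‖y‖ ≤ R := by
      rw [ae_iff]
      exact measure_mono_null (fun y hy hyT ↦ hy (hR y hyT)) hμT
    refine ⟨B * (1 + |R|), by positivity, fun m x ↦ ?_⟩
    -- No derivative gains a factor here, so the first-order bound serves as a Lipschitz constant.
    -- The limit constant is the `μ`-mean of the iterate over the bounded set `T`, and `‖x - y‖`
    -- causes the linear growth.
    have hlip : ∀ y, ‖(averaging n hn A)^[m] g x - (averaging n hn A)^[m] g y‖ ≤
        B * ((n : ℝ)⁻¹) ^ m * ‖x - y‖ := fun y ↦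
      Convex.norm_image_sub_le_of_norm_deriv_le (s := Set.univ)
        (fun z _ ↦ (SchwartzMap.differentiable _).differentiableAt)
        (fun z _ ↦ by simpa using hB m z) convex_univ (Set.mem_univ _) (Set.mem_univ _)
    have hint : Integrable (fun y ↦ (averaging n hn A)^[m] g y) μ :=
      Integrable.of_bound (SchwartzMap.continuous _).aestronglyMeasurable _
        (.of_forall fun x ↦ SchwartzMap.norm_le_seminorm ℝ _ _)
    rw [norm_iteratedFDeriv_zero, ← integral_iterate_averaging hn h g m]
    have hc : (averaging n hn A)^[m] g x - ∫ y, (averaging n hn A)^[m] g y ∂μ =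
        ∫ y, ((averaging n hn A)^[m] g x - (averaging n hn A)^[m] g y) ∂μ := by
      rw [integral_sub (integrable_const _) hint]
      simp
    rw [hc]
    refine (norm_integral_le_of_norm_le_const
      (C := B * (1 + |R|) * (1 + ‖x‖) * ((n : ℝ)⁻¹) ^ m) ?_).trans (by simp)
    filter_upwards [hae] with y hy
    refine (hlip y).trans ?_
    have hxy : ‖x - y‖ ≤ (1 + |R|) * (1 + ‖x‖) := by
      have := norm_sub_le x y
      have := le_abs_self R
      nlinarith [norm_nonneg x, abs_nonneg R]
    calc B * ((n : ℝ)⁻¹) ^ m * ‖x - y‖ ≤ B * ((n : ℝ)⁻¹) ^ m * ((1 + |R|) * (1 + ‖x‖)) := by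
          gcongr
      _ = _ := by ring
  · obtain ⟨B, hB0, hB⟩ := exists_norm_iteratedDeriv_averaging_le hn hA g hj
    refine ⟨B, hB0, fun m x ↦ ?_⟩
    rw [norm_iteratedFDeriv_eq_norm_iteratedDeriv]
    obtain ⟨i, rfl⟩ := Nat.exists_eq_succ_of_ne_zero hj
    have he : iteratedDeriv (i + 1) (fun x ↦ (averaging n hn A)^[m] g x - ∫ y, g y ∂μ) =
        iteratedDeriv (i + 1) ((averaging n hn A)^[m] g) := by
      rw [iteratedDeriv_succ', iteratedDeriv_succ']
      congr 1
      ext x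
      simp
    rw [Nat.succ_eq_add_one, he]
    refine (hB m x).trans ?_
    gcongr
    exact le_mul_of_one_le_right hB0 (by linarith [norm_nonneg x])

/-- A nonzero constant is not a Schwartz function, hence the cutoff `χ`. Its decay absorbs the
linear growth, at the cost of the seminorms of order `k + 1` in `M`. -/
theorem tendsto_smulLeftCLM_iterate_averaging {n : ℕ} (hn : 2 ≤ n) {A : Finset ℕ}
    (hA : A.card = n) {μ : Measure ℝ} [IsProbabilityMeasure μ] (h : IsSelfSimilar n A μ)
    {T : Set ℝ} (hT : IsCompact T) (hμT : μ Tᶜ = 0) (g χ : 𝓢(ℝ, ℂ)) :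
    Filter.Tendsto
      (fun m ↦ SchwartzMap.smulLeftCLM ℂ χ ((averaging n (two_pos.trans_le hn).ne' A)^[m] g))
      Filter.atTop (𝓝 ((∫ x, g x ∂μ) • χ)) := by
  have hn' : n ≠ 0 := (two_pos.trans_le hn).ne'
  rw [(schwartz_withSeminorms ℝ ℝ ℂ).tendsto_nhds]
  rintro ⟨k, l⟩ ε hε
  choose C hC0 hC using exists_norm_iteratedFDeriv_averaging_sub_le hn' hA h hT hμT g
  set M : ℝ := ∑ i ∈ Finset.range (l + 1), (l.choose i : ℝ) *
    (SchwartzMap.seminorm ℝ k i χ + SchwartzMap.seminorm ℝ (k + 1) i χ) * C (l - i) with hM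
  have hM0 : 0 ≤ M := Finset.sum_nonneg fun i _ ↦ by have := hC0 (l - i); positivity
  have hbound : ∀ m, SchwartzMap.seminorm ℝ k l (SchwartzMap.smulLeftCLM ℂ χ
      ((averaging n hn' A)^[m] g) - (∫ x, g x ∂μ) • χ) ≤ M * ((n : ℝ)⁻¹) ^ m := by
    intro m
    refine SchwartzMap.seminorm_le_bound ℝ k l _ (by positivity) fun x ↦ ?_
    have he : ((SchwartzMap.smulLeftCLM ℂ χ ((averaging n hn' A)^[m] g) -
        (∫ x, g x ∂μ) • χ : 𝓢(ℝ, ℂ)) : ℝ → ℂ) =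
        fun x ↦ χ x * ((averaging n hn' A)^[m] g x - ∫ y, g y ∂μ) := by
      ext x
      simp only [sub_apply, smul_apply,
        SchwartzMap.smulLeftCLM_apply_apply χ.hasTemperateGrowth, smul_eq_mul]
      ring
    rw [he]
    have hle := norm_iteratedFDeriv_mul_le (𝕜 := ℝ) (N := l) (χ.smooth l)
      ((((averaging n hn' A)^[m] g).smooth l).sub contDiff_const) x (n := l) le_rfl
      (g := fun x ↦ (averaging n hn' A)^[m] g x - ∫ y, g y ∂μ)
    refine (mul_le_mul_of_nonneg_left hle (by positivity)).trans ?_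
    rw [Finset.mul_sum, hM, Finset.sum_mul]
    refine Finset.sum_le_sum fun i _ ↦ ?_
    have h1 := SchwartzMap.le_seminorm ℝ k i χ x
    have h2 := SchwartzMap.le_seminorm ℝ (k + 1) i χ x
    have h3 := hC (l - i) m x
    have := hC0 (l - i)
    calc ‖x‖ ^ k * ((l.choose i : ℝ) * ‖iteratedFDeriv ℝ i χ x‖ * ‖iteratedFDeriv ℝ (l - i)
          (fun x ↦ (averaging n hn' A)^[m] g x - ∫ y, g y ∂μ) x‖)
        ≤ ‖x‖ ^ k * ((l.choose i : ℝ) * ‖iteratedFDeriv ℝ i χ x‖ *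
          (C (l - i) * (1 + ‖x‖) * ((n : ℝ)⁻¹) ^ m)) := by gcongr
      _ = (l.choose i : ℝ) * (‖x‖ ^ k * ‖iteratedFDeriv ℝ i χ x‖ +
          ‖x‖ ^ (k + 1) * ‖iteratedFDeriv ℝ i χ x‖) * C (l - i) * ((n : ℝ)⁻¹) ^ m := by ring
      _ ≤ _ := by gcongr
  have hlim : Filter.Tendsto (fun m ↦ M * ((n : ℝ)⁻¹) ^ m) Filter.atTop (𝓝 0) := by
    have hn1 : (1 : ℝ) < n := by exact_mod_cast hn
    simpa using (tendsto_pow_atTop_nhds_zero_of_lt_one (r := (n : ℝ)⁻¹) (by positivity)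
      (inv_lt_one_of_one_lt₀ hn1)).const_mul M
  filter_upwards [hlim.eventually (gt_mem_nhds hε)] with m hm
  exact (hbound m).trans_lt hm

/-- Smooth cutoff functions. -/
theorem exists_schwartzMap_eq_one_nhdsSet {K U : Set ℝ} (hK : IsCompact K) (hU : IsOpen U)
    (hKU : K ⊆ U) : ∃ χ : 𝓢(ℝ, ℂ), HasCompactSupport χ ∧ (∀ᶠ x in 𝓝ˢ K, χ x = 1) ∧
      (∀ x, ‖χ x‖ ≤ 1) ∧ ∀ x ∉ U, χ x = 0 := by
  obtain ⟨L, hL, hKL, hLU⟩ := exists_compact_between hK hU hKU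
  obtain ⟨f, hf1, hf0, hfI⟩ := exists_contMDiffMap_one_nhds_of_subset_interior 𝓘(ℝ, ℝ) (n := (⊤ : ℕ∞))
    hK.isClosed hKL
  have hsupp : HasCompactSupport fun x ↦ (f x : ℂ) :=
    HasCompactSupport.intro hL fun x hx ↦ by simp [hf0 x hx]
  have hdiff : ContDiff ℝ (⊤ : ℕ∞) fun x ↦ (f x : ℂ) :=
    Complex.ofRealCLM.contDiff.comp f.contMDiff.contDiff
  refine ⟨hsupp.toSchwartzMap hdiff, hsupp, ?_, fun x ↦ ?_, fun x hx ↦ ?_⟩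
  · filter_upwards [hf1] with x hx
    simp [hx]
  · have := hfI x
    simp [abs_le, this.2, show -1 ≤ f x by linarith [this.1]]
  · simp [hf0 x fun h ↦ hx (hLU h)]

theorem SupportedIn.apply_eq {f : 𝓢'(ℝ, ℂ)} {K : Set ℝ} (hf : SupportedIn f K)
    {g g' : 𝓢(ℝ, ℂ)} (h : ∀ᶠ x in 𝓝ˢ K, g x = g' x) : f g = f g' := by
  rw [← sub_eq_zero, ← map_sub]
  refine hf _ fun x hx hxK ↦ ?_
  rw [Filter.Eventually, mem_nhdsSet_iff_forall] at h
  refine notMem_tsupport_iff_eventuallyEq.2 ?_ hx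
  filter_upwards [h x hxK] with y hy
  simp [hy]

/-- By the refinement equation `φ` takes the same value on all iterates of `g`, with or without the
cutoff. In the limit that value is `∫ g dμ` times `φ χ = 1`. -/
theorem IsRefinable.apply_eq_integral {n : ℕ} (hn : 2 ≤ n) {A : Finset ℕ} (hA : A.card = n)
    {μ : Measure ℝ} [IsProbabilityMeasure μ] (h : IsSelfSimilar n A μ)
    {T : Set ℝ} (hT : IsCompact T) (hμT : μ Tᶜ = 0) {φ : 𝓢'(ℝ, ℂ)}
    (hφ : IsRefinable n (two_pos.trans_le hn).ne' A φ) (g : 𝓢(ℝ, ℂ)) :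
    φ g = ∫ x, g x ∂μ := by
  obtain ⟨K, hK, hφK⟩ := hφ.compact_support
  obtain ⟨χ, -, hχ, -⟩ := exists_schwartzMap_eq_one_nhdsSet hK isOpen_univ (Set.subset_univ K)
  have hS : ∀ m, φ ((averaging n (two_pos.trans_le hn).ne' A)^[m] g) = φ g := by
    intro m
    induction m with
    | zero => rfl
    | succ m ih => rw [Function.iterate_succ_apply', ← transition_apply, hφ.refinement, ih]
  have hconst : ∀ m, φ (SchwartzMap.smulLeftCLM ℂ χ
      ((averaging n (two_pos.trans_le hn).ne' A)^[m] g)) = φ g := by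
    intro m
    rw [← hS m]
    refine hφK.apply_eq ?_
    filter_upwards [hχ] with x hx
    simp [SchwartzMap.smulLeftCLM_apply_apply χ.hasTemperateGrowth, hx]
  have hlim := ((map_continuous φ).tendsto _).comp
    (tendsto_smulLeftCLM_iterate_averaging hn hA h hT hμT g χ)
  simp only [Function.comp_def, hconst, map_smul, hφ.normalized K hK hφK χ hχ, smul_eq_mul,
    mul_one] at hlim
  exact tendsto_nhds_unique tendsto_const_nhds hlim

theorem IsSelfSimilar.isRefinable {n : ℕ} (hn : n ≠ 0) {A : Finset ℕ}
    {μ : Measure ℝ} [IsProbabilityMeasure μ] (h : IsSelfSimilar n A μ)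
    {T : Set ℝ} (hT : IsCompact T) (hμT : μ Tᶜ = 0) :
    IsRefinable n hn A μ.toTemperedDistribution := by
  have hae : ∀ᵐ x ∂μ, x ∈ T := hμT
  refine ⟨⟨T, hT, fun u hu ↦ ?_⟩, ?_, fun K hK hμK χ hχ ↦ ?_⟩
  · rw [Measure.toTemperedDistribution_apply μ]
    refine integral_eq_zero_of_ae ?_
    filter_upwards [hae] with x hx
    by_contra hne
    exact hu (subset_tsupport _ hne) hx
  · ext g
    rw [transition_apply, Measure.toTemperedDistribution_apply μ,
      Measure.toTemperedDistribution_apply μ]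
    exact integral_iterate_averaging hn h g 1
  -- `K` is not known to contain `T`, so `χ` is exchanged for a function equal to 1 near both.
  · obtain ⟨χ', -, hχ', -⟩ := exists_schwartzMap_eq_one_nhdsSet (hK.union hT) isOpen_univ
      (Set.subset_univ _)
    have : ∀ᶠ x in 𝓝ˢ K, χ x = χ' x := by
      filter_upwards [hχ, nhdsSet_mono Set.subset_union_left hχ'] with x hx hx'
      rw [hx, hx']
    rw [hμK.apply_eq this, Measure.toTemperedDistribution_apply μ]
    have h1 : ∀ᵐ x ∂μ, χ' x = 1 := by
      filter_upwards [hae] with x hx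
      exact hχ'.self_of_nhdsSet x (Or.inr hx)
    rw [integral_congr_ae h1]
    simp

end

section

open scoped ENNReal Pointwise

/-! ### Unique expansions and digit sums -/

/-- The integers `∑_{j < J} α_j n ^ j` with all `α_j ∈ A`. -/
def digitSums (n : ℕ) (A : Finset ℕ) : ℕ → Finset ℕ
  | 0 => {0}
  | J + 1 => (A ×ˢ digitSums n A J).image fun p ↦ p.1 + n * p.2

theorem mem_digitSums {n : ℕ} {A : Finset ℕ} {J k : ℕ} :
    k ∈ digitSums n A J ↔
      ∃ l : List ℕ, l.length = J ∧ (∀ d ∈ l, d ∈ A) ∧ Nat.ofDigits n l = k := by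
  induction J generalizing k with
  | zero =>
    simp only [digitSums, Finset.mem_singleton, List.length_eq_zero_iff]
    constructor
    · rintro rfl
      exact ⟨[], rfl, by simp, rfl⟩
    · rintro ⟨l, rfl, -, rfl⟩
      rfl
  | succ J ih =>
    simp only [digitSums, Finset.mem_image, Finset.mem_product, Prod.exists]
    constructor
    · rintro ⟨a, d, ⟨ha, hd⟩, rfl⟩
      obtain ⟨l, hl, hlA, rfl⟩ := ih.1 hd
      refine ⟨a :: l, by simp [hl], ?_, by simp [Nat.ofDigits_cons]⟩
      simpa using ⟨ha, hlA⟩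
    · rintro ⟨l, hl, hlA, rfl⟩
      obtain ⟨a, l, rfl⟩ := List.exists_of_length_succ l hl
      refine ⟨a, Nat.ofDigits n l, ⟨hlA _ (by simp), ih.2 ⟨l, by simpa using hl, ?_, rfl⟩⟩,
        by simp [Nat.ofDigits_cons]⟩
      exact fun d hd ↦ hlA d (by simp [hd])

/-- The digits of the elements of `digitSums n A J` are determined by these integers. -/
def HasInjectiveDigits (n : ℕ) (A : Finset ℕ) : Prop :=
  ∀ J, Set.InjOn (fun p : ℕ × ℕ ↦ p.1 + n * p.2) (A ×ˢ digitSums n A J : Finset (ℕ × ℕ))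

/-- Links digit lists of fixed length with expansions, by stripping zeros at the most significant
end. -/
theorem exists_isExpansion_append {n : ℕ} {A : Finset ℕ} (l : List ℕ) (hl : ∀ d ∈ l, d ∈ A) :
    ∃ (l₀ : List ℕ) (r : ℕ), l = l₀ ++ List.replicate r 0 ∧
      IsExpansion n A (Nat.ofDigits n l) l₀ := by
  induction l using List.reverseRecOn with
  | nil => exact ⟨[], 0, rfl, by simp, by simp, rfl⟩
  | append_singleton l d ih =>
    rcases eq_or_ne d 0 with rfl | hd
    · obtain ⟨l₀, r, rfl, h⟩ := ih fun d hd ↦ hl d (by simp [hd])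
      refine ⟨l₀, r + 1, by simp [List.replicate_succ'], ?_⟩
      simpa [Nat.ofDigits_append, Nat.ofDigits_singleton] using h
    · exact ⟨l ++ [d], 0, by simp, hl, by simpa using hd, rfl⟩

theorem HasUniqueExpansions.hasInjectiveDigits {n : ℕ} {A : Finset ℕ}
    (h : HasUniqueExpansions n A) : HasInjectiveDigits n A := by
  rintro J ⟨a, d⟩ had ⟨a', d'⟩ had' heq
  simp only [Finset.coe_product, Set.mem_prod, Finset.mem_coe] at had had'
  obtain ⟨l, hl, hlA, rfl⟩ := mem_digitSums.1 had.2
  obtain ⟨l', hl', hlA', rfl⟩ := mem_digitSums.1 had'.2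
  obtain ⟨l₀, r, hr, he⟩ := exists_isExpansion_append (n := n) (A := A) (a :: l)
    (by simpa using ⟨had.1, hlA⟩)
  obtain ⟨l₀', r', hr', he'⟩ := exists_isExpansion_append (n := n) (A := A) (a' :: l')
    (by simpa using ⟨had'.1, hlA'⟩)
  have hsum : Nat.ofDigits n (a :: l) = Nat.ofDigits n (a' :: l') := by
    simpa [Nat.ofDigits_cons] using heq
  obtain rfl : l₀ = l₀' := h _ _ _ he (hsum ▸ he')
  have hlen : (a :: l).length = (a' :: l').length := by simp [hl, hl']
  rw [hr, hr'] at hlen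
  simp only [List.length_append, List.length_replicate, Nat.add_left_cancel_iff] at hlen
  have : a :: l = a' :: l' := by rw [hr, hr', hlen]
  simp only [List.cons.injEq] at this
  rw [this.1, this.2]

theorem HasInjectiveDigits.eq_of_ofDigits_eq {n : ℕ} {A : Finset ℕ} (h : HasInjectiveDigits n A)
    {l l' : List ℕ} (hl : ∀ d ∈ l, d ∈ A) (hl' : ∀ d ∈ l', d ∈ A) (hlen : l.length = l'.length)
    (heq : Nat.ofDigits n l = Nat.ofDigits n l') : l = l' := by
  induction l generalizing l' with
  | nil => exact (List.length_eq_zero_iff.1 hlen.symm).symm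
  | cons a l ih =>
    obtain ⟨a', l', rfl⟩ := List.exists_of_length_succ l' hlen.symm
    simp only [List.mem_cons, forall_eq_or_imp] at hl hl'
    simp only [List.length_cons, Nat.add_right_cancel_iff] at hlen
    have := @h l.length (a, Nat.ofDigits n l)
      (by simpa using ⟨hl.1, mem_digitSums.2 ⟨l, rfl, hl.2, rfl⟩⟩) (a', Nat.ofDigits n l')
      (by simpa using ⟨hl'.1, mem_digitSums.2 ⟨l', hlen.symm, hl'.2, rfl⟩⟩)
      (by simpa [Nat.ofDigits_cons] using heq)
    simp only [Prod.mk.injEq] at this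
    rw [this.1, ih hl.2 hl'.2 hlen this.2]

theorem HasInjectiveDigits.hasUniqueExpansions {n : ℕ} {A : Finset ℕ} (h0 : 0 ∈ A)
    (h : HasInjectiveDigits n A) : HasUniqueExpansions n A := by
  have key : ∀ (k : ℕ) (l l' : List ℕ), IsExpansion n A k l → IsExpansion n A k l' →
      l.length ≤ l'.length → l = l' := by
    intro k l l' hl hl' hlen
    -- Padding the shorter list is legitimate because `0 ∈ A`. A nonempty padding would make the
    -- leading digit of `l'` zero.
    have hpad : l ++ List.replicate (l'.length - l.length) 0 = l' := by
      refine h.eq_of_ofDigits_eq ?_ hl'.1 (by simp [hlen]) ?_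
      · intro d hd
        rcases List.mem_append.1 hd with hd | hd
        · exact hl.1 d hd
        · rwa [List.eq_of_mem_replicate hd]
      · rw [Nat.ofDigits_append, hl.2.2, hl'.2.2]
        simp
    rcases Nat.eq_zero_or_pos (l'.length - l.length) with hr | hr
    · simpa [hr] using hpad
    · exfalso
      obtain ⟨r, hr⟩ := Nat.exists_eq_succ_of_ne_zero hr.ne'
      rw [hr, Nat.succ_eq_add_one, List.replicate_succ', ← List.append_assoc] at hpad
      have hne : l' ≠ [] := by rintro rfl; simp at hpad
      refine hl'.2.1 hne ?_
      simp [← hpad]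
  intro k l l' hl hl'
  rcases le_total l.length l'.length with hlen | hlen
  · exact key k l l' hl hl' hlen
  · exact (key k l' l hl' hl hlen).symm

theorem card_digitSums_le {n : ℕ} {A : Finset ℕ} (hA : A.card = n) (J : ℕ) :
    (digitSums n A J).card ≤ n ^ J := by
  induction J with
  | zero => simp [digitSums]
  | succ J ih =>
    refine Finset.card_image_le.trans ?_
    rw [Finset.card_product, hA, pow_succ']
    gcongr

theorem exists_card_digitSums_lt {n : ℕ} {A : Finset ℕ} (hA : A.card = n)
    (h : ¬ HasInjectiveDigits n A) : ∃ J, (digitSums n A J).card < n ^ J := by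
  obtain ⟨J, hJ⟩ := not_forall.1 h
  refine ⟨J + 1, (lt_of_le_of_ne Finset.card_image_le
    fun he ↦ hJ (Finset.card_image_iff.1 he)).trans_le ?_⟩
  rw [Finset.card_product, hA, pow_succ']
  have := card_digitSums_le hA J
  gcongr

/-! ### Unique expansions imply absolute continuity -/

/-- Iterated self-similarity averages over digit words; injectivity lets the sum run over distinct
integers. -/
theorem IsSelfSimilar.measure_eq_sum {n : ℕ} (hn : n ≠ 0) {A : Finset ℕ} {μ : Measure ℝ}
    (h : IsSelfSimilar n A μ) (hinj : HasInjectiveDigits n A) (J : ℕ) {E : Set ℝ}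
    (hE : MeasurableSet E) :
    μ E = ((n : ℝ≥0∞) ^ J)⁻¹ * ∑ d ∈ digitSums n A J, μ ((fun x : ℝ ↦ (x + d) / n ^ J) ⁻¹' E) := by
  have hn' : (n : ℝ) ≠ 0 := by exact_mod_cast hn
  induction J with
  | zero => simp [digitSums]
  | succ J ih =>
    rw [ih, digitSums, Finset.sum_image (hinj J), Finset.sum_product_right, pow_succ,
      ENNReal.mul_inv (by simp) (by simp), mul_assoc]
    congr 1
    rw [Finset.mul_sum]
    refine Finset.sum_congr rfl fun d _ ↦ ?_
    have hm : MeasurableSet ((fun x : ℝ ↦ (x + d) / n ^ J) ⁻¹' E) :=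
      (by fun_prop : Measurable fun x : ℝ ↦ (x + d) / (n : ℝ) ^ J) hE
    conv_lhs => rw [show μ = _ from h]
    simp only [Measure.smul_apply, Measure.coe_finsetSum, Finset.sum_apply, smul_eq_mul]
    congr 1
    refine Finset.sum_congr rfl fun a _ ↦ ?_
    rw [Measure.map_apply (by fun_prop) hm]
    congr 1
    ext x
    simp only [Set.mem_preimage]
    have : ((x + a) / n + d) / (n : ℝ) ^ J = (x + ((a + n * d : ℕ) : ℝ)) / n ^ (J + 1) := by
      push_cast
      rw [pow_succ]
      field_simp
      ring
    rw [this]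

theorem card_filter_add_mem_Ioc_le (s : Finset ℕ) (x : ℝ) {α β : ℝ} (h : α ≤ β) :
    ((s.filter fun d : ℕ ↦ x + d ∈ Set.Ioc α β).card : ℝ) ≤ β - α + 1 := by
  have hle : (s.filter fun d : ℕ ↦ x + d ∈ Set.Ioc α β).card ≤
      (Finset.Ioc ⌊α - x⌋ ⌊β - x⌋).card := by
    refine Finset.card_le_card_of_injOn (fun d : ℕ ↦ (d : ℤ)) ?_ Nat.cast_injective.injOn
    intro d hd
    simp only [Finset.coe_filter, Set.mem_Ioc, Set.mem_ofPred_eq] at hd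
    simp only [Finset.coe_Ioc, Set.mem_Ioc, Int.floor_lt, Int.le_floor, Int.cast_natCast]
    constructor <;> linarith [hd.2.1, hd.2.2]
  have hfl : ⌊α - x⌋ ≤ ⌊β - x⌋ := Int.floor_le_floor (by linarith)
  have hcard : ((Finset.Ioc ⌊α - x⌋ ⌊β - x⌋).card : ℝ) = (⌊β - x⌋ : ℝ) - ⌊α - x⌋ := by
    rw [Int.card_Ioc, ← Int.cast_sub, ← Int.cast_natCast, Int.toNat_of_nonneg (sub_nonneg.2 hfl)]
  have := Int.floor_le (β - x)
  have := Int.lt_floor_add_one (α - x)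
  calc ((s.filter fun d : ℕ ↦ x + d ∈ Set.Ioc α β).card : ℝ)
      ≤ ((Finset.Ioc ⌊α - x⌋ ⌊β - x⌋).card : ℝ) := by exact_mod_cast hle
    _ ≤ β - α + 1 := by rw [hcard]; linarith

theorem sum_measure_preimage_Ioc_le {μ : Measure ℝ} [IsProbabilityMeasure μ] (s : Finset ℕ)
    {α β : ℝ} (h : α ≤ β) :
    ∑ d ∈ s, μ ((fun x : ℝ ↦ x + d) ⁻¹' Set.Ioc α β) ≤ ENNReal.ofReal (β - α + 1) := by
  have hm : ∀ d : ℕ, MeasurableSet ((fun x : ℝ ↦ x + d) ⁻¹' Set.Ioc α β) := fun d ↦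
    measurable_add_const _ measurableSet_Ioc
  have h1 : ∀ d ∈ s, μ ((fun x : ℝ ↦ x + d) ⁻¹' Set.Ioc α β) =
      ∫⁻ x, ((fun x : ℝ ↦ x + d) ⁻¹' Set.Ioc α β).indicator 1 x ∂μ := fun d _ ↦
    (lintegral_indicator_one (hm d)).symm
  rw [Finset.sum_congr rfl h1, ← lintegral_finsetSum _ fun d _ ↦ measurable_one.indicator (hm d)]
  refine (lintegral_mono (g := fun _ ↦ ENNReal.ofReal (β - α + 1)) fun x ↦ ?_).trans (by simp)
  have : ∑ d ∈ s, ((fun x : ℝ ↦ x + d) ⁻¹' Set.Ioc α β).indicator (1 : ℝ → ℝ≥0∞) x =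
      (s.filter fun d : ℕ ↦ x + d ∈ Set.Ioc α β).card := by
    rw [Finset.card_filter]
    push_cast
    simp [Set.indicator_apply, sub_lt_iff_lt_add, le_sub_iff_add_le]
  simp only [this]
  rw [← ENNReal.ofReal_natCast]
  exact ENNReal.ofReal_le_ofReal (card_filter_add_mem_Ioc_le s x h)

/-- The interval scaled by `n^J` contains at most `(b - a) n^J + 1` integer translates of a point.
Dividing by `n^J` leaves an error `n^(-J)`, which tends to 0. -/
theorem IsSelfSimilar.measure_Ioc_le {n : ℕ} (hn : 2 ≤ n) {A : Finset ℕ} {μ : Measure ℝ}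
    [IsProbabilityMeasure μ] (h : IsSelfSimilar n A μ) (hinj : HasInjectiveDigits n A) (a b : ℝ) :
    μ (Set.Ioc a b) ≤ ENNReal.ofReal (b - a) := by
  rcases le_or_gt b a with hab | hab
  · simp [Set.Ioc_eq_empty (not_lt.2 hab)]
  have hn1 : (1 : ℝ) < n := by exact_mod_cast hn
  have hbound : ∀ J : ℕ, μ (Set.Ioc a b) ≤ ENNReal.ofReal (b - a + ((n : ℝ)⁻¹) ^ J) := by
    intro J
    have hJ : (0 : ℝ) < (n : ℝ) ^ J := by positivity
    have hpre : ∀ d : ℕ, (fun x : ℝ ↦ (x + d) / n ^ J) ⁻¹' Set.Ioc a b =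
        (fun x : ℝ ↦ x + d) ⁻¹' Set.Ioc (a * n ^ J) (b * n ^ J) := by
      intro d
      ext x
      simp only [Set.mem_preimage, Set.mem_Ioc, lt_div_iff₀ hJ, div_le_iff₀ hJ]
    rw [h.measure_eq_sum (by omega) hinj J measurableSet_Ioc]
    simp_rw [hpre]
    refine (mul_le_mul_right (sum_measure_preimage_Ioc_le (digitSums n A J)
      (by gcongr : a * (n : ℝ) ^ J ≤ b * n ^ J)) _).trans ?_
    rw [← ENNReal.ofReal_natCast, ← ENNReal.ofReal_pow (by positivity),
      ← ENNReal.ofReal_inv_of_pos hJ, ← ENNReal.ofReal_mul (by positivity)]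
    refine ENNReal.ofReal_le_ofReal (le_of_eq ?_)
    rw [inv_pow]
    field_simp
  refine ge_of_tendsto' (ENNReal.tendsto_ofReal (f := Filter.atTop) ?_) hbound
  simpa using (tendsto_pow_atTop_nhds_zero_of_lt_one (r := (n : ℝ)⁻¹) (by positivity)
      (inv_lt_one_of_one_lt₀ hn1)).const_add (b - a)

/-- Lebesgue outer measure is the largest outer measure bounded by interval lengths. -/
theorem le_volume_of_forall_Ioc {μ : Measure ℝ}
    (h : ∀ a b, μ (Set.Ioc a b) ≤ ENNReal.ofReal (b - a)) : μ ≤ volume := by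
  have hle : μ.toOuterMeasure ≤ StieltjesFunction.id.outer := by
    refine OuterMeasure.le_ofFunction.2 fun s ↦ ?_
    rw [StieltjesFunction.length_eq]
    refine le_iInf fun a ↦ le_iInf fun b ↦ le_iInf fun hs ↦ ?_
    have hbot : (botSet : Set ℝ) = ∅ := by
      ext x
      simp [botSet, not_isBot]
    rw [hbot, Set.sdiff_empty] at hs
    exact (measure_mono hs).trans (h a b)
  refine Measure.le_iff'.2 fun s ↦ (hle s).trans ?_
  rw [Real.volume_eq_stieltjes_id, StieltjesFunction.measure]
  exact le_rfl

theorem memL1_of_absolutelyContinuous {μ : Measure ℝ} [IsFiniteMeasure μ] (h : μ ≪ volume)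
    {φ : 𝓢'(ℝ, ℂ)} (hφ : ∀ g : 𝓢(ℝ, ℂ), φ g = ∫ x, g x ∂μ) : MemL1 φ := by
  have hint : Integrable (fun x ↦ ((μ.rnDeriv volume x).toReal : ℂ)) volume :=
    Measure.integrable_toReal_rnDeriv.ofReal
  refine ⟨hint.toL1 _, ?_⟩
  ext g
  rw [Lp.toTemperedDistribution_apply, hφ, ← integral_rnDeriv_smul h]
  refine integral_congr_ae ?_
  filter_upwards [hint.coeFn_toL1] with x hx
  rw [hx, Complex.real_smul, smul_eq_mul, mul_comm]

/-! ### Absolute continuity implies unique expansions -/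

/-- If `T` were null, `f` would have `L₁` mass below 1 on some open `U ⊇ T`. A cutoff that is 1 near
`T` and 0 off `U` must nevertheless pair with `φ` to 1. -/
theorem MemL1.volume_ne_zero {φ : 𝓢'(ℝ, ℂ)} (h : MemL1 φ) {μ : Measure ℝ} [IsProbabilityMeasure μ]
    (hφ : ∀ g : 𝓢(ℝ, ℂ), φ g = ∫ x, g x ∂μ) {T : Set ℝ} (hT : IsCompact T) (hμT : μ Tᶜ = 0) :
    volume T ≠ 0 := by
  intro hvol
  obtain ⟨f, hf⟩ := h
  have hfi : ∫⁻ x, ‖f x‖ₑ ≠ ∞ := (L1.integrable_coeFn f).2.ne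
  obtain ⟨δ, hδ, hδf⟩ := exists_pos_setLIntegral_lt_of_measure_lt hfi one_ne_zero
  obtain ⟨U, hTU, hU, hUδ⟩ := T.exists_isOpen_lt_of_lt δ (by rwa [hvol])
  obtain ⟨χ, -, hχ1, hχ, hχ0⟩ := exists_schwartzMap_eq_one_nhdsSet hT hU hTU
  have h1 : φ χ = 1 := by
    have hae : ∀ᵐ x ∂μ, χ x = 1 := by
      filter_upwards [show ∀ᵐ x ∂μ, x ∈ T from hμT] with x hx
      exact hχ1.self_of_nhdsSet x hx
    rw [hφ, integral_congr_ae hae]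
    simp
  have h2 : ‖φ χ‖ₑ < 1 := by
    rw [← hf, Lp.toTemperedDistribution_apply]
    refine (enorm_integral_le_lintegral_enorm _).trans_lt (lt_of_le_of_lt ?_ (hδf U hUδ))
    rw [← lintegral_indicator hU.measurableSet]
    refine lintegral_mono fun x ↦ ?_
    by_cases hx : x ∈ U
    · rw [Set.indicator_of_mem hx, enorm_smul]
      refine mul_le_of_le_one_left' ?_
      rw [← ofReal_norm]
      exact ENNReal.ofReal_le_one.2 (hχ x)
    · simp [hχ0 x hx]
  simp [h1] at h2

theorem subset_iUnion_digitSums {n : ℕ} (hn : n ≠ 0) {A : Finset ℕ} {T : Set ℝ}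
    (hT : T ⊆ ⋃ a ∈ A, (fun x : ℝ ↦ (x + a) / n) '' T) (J : ℕ) :
    T ⊆ ⋃ d ∈ digitSums n A J, (fun x : ℝ ↦ (x + d) / n ^ J) '' T := by
  have hn' : (n : ℝ) ≠ 0 := by exact_mod_cast hn
  induction J with
  | zero => simp [digitSums]
  | succ J ih =>
    intro x hx
    obtain ⟨d, hd, y, hy, rfl⟩ := Set.mem_iUnion₂.1 (ih hx)
    obtain ⟨a, ha, z, hz, rfl⟩ := Set.mem_iUnion₂.1 (hT hy)
    refine Set.mem_iUnion₂.2 ⟨a + n * d, ?_, z, hz, ?_⟩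
    · exact Finset.mem_image.2 ⟨(a, d), Finset.mem_product.2 ⟨ha, hd⟩, rfl⟩
    · push_cast
      rw [pow_succ]
      field_simp
      ring

/-- Fewer than `n^J` copies of volume `n^(-J) volume T` cover `T`, whose volume is finite. -/
theorem volume_eq_zero_of_not_hasInjectiveDigits {n : ℕ} (hn : n ≠ 0) {A : Finset ℕ}
    (hA : A.card = n) (hinj : ¬ HasInjectiveDigits n A) {T : Set ℝ} (hTc : IsCompact T)
    (hT : T ⊆ ⋃ a ∈ A, (fun x : ℝ ↦ (x + a) / n) '' T) : volume T = 0 := by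
  obtain ⟨J, hJ⟩ := exists_card_digitSums_lt hA hinj
  have hpos : (0 : ℝ) < (n : ℝ) ^ J := by positivity
  have himg : ∀ d : ℕ, volume ((fun x : ℝ ↦ (x + d) / n ^ J) '' T) =
      ENNReal.ofReal ((n : ℝ) ^ J)⁻¹ * volume T := by
    intro d
    have : (fun x : ℝ ↦ (x + d) / n ^ J) '' T = ((n : ℝ) ^ J)⁻¹ • ((d : ℝ) +ᵥ T) := by
      ext x
      simp only [Set.mem_image, Set.mem_smul_set, Set.mem_vadd_set, exists_exists_and_eq_and,
        smul_eq_mul, vadd_eq_add]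
      refine exists_congr fun y ↦ and_congr_right fun _ ↦ ?_
      rw [div_eq_inv_mul, add_comm]
    rw [this, Measure.addHaar_smul, measure_vadd, Module.finrank_self, pow_one,
      abs_of_pos (by positivity)]
  by_contra hne
  have hle : volume T ≤
      (digitSums n A J).card * (ENNReal.ofReal ((n : ℝ) ^ J)⁻¹ * volume T) := by
    calc volume T ≤ volume (⋃ d ∈ digitSums n A J, (fun x : ℝ ↦ (x + d) / n ^ J) '' T) :=
          measure_mono (subset_iUnion_digitSums hn hT J)
      _ ≤ ∑ d ∈ digitSums n A J, volume ((fun x : ℝ ↦ (x + d) / n ^ J) '' T) :=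
          measure_biUnion_finset_le _ _
      _ = _ := by simp [himg]
  have hlt : (digitSums n A J).card * (ENNReal.ofReal ((n : ℝ) ^ J)⁻¹ * volume T) <
      1 * volume T := by
    rw [← mul_assoc]
    refine (ENNReal.mul_lt_mul_iff_left hne hTc.measure_lt_top.ne).2 ?_
    rw [← ENNReal.ofReal_natCast, ← ENNReal.ofReal_mul (by positivity), ← ENNReal.ofReal_one]
    refine (ENNReal.ofReal_lt_ofReal_iff one_pos).2 ?_
    rw [← div_eq_mul_inv, div_lt_one hpos]
    exact_mod_cast hJ
  rw [one_mul] at hlt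
  exact absurd hle (not_le.2 hlt)

end

section

open scoped ENNReal FourierTransform

/-! ### The mask -/

theorem mask_add_intCast (n : ℕ) (A : Finset ℕ) (t : ℝ) (k : ℤ) :
    mask n A (t + k) = mask n A t := by
  unfold mask
  congr 1
  refine Finset.sum_congr rfl fun a _ ↦ ?_
  have : (-2 * Real.pi * Complex.I * (a : ℂ) * ((t + k : ℝ) : ℂ)) =
      -2 * Real.pi * Complex.I * (a : ℂ) * (t : ℂ) +
        ((-(a * k) : ℤ) : ℂ) * (2 * Real.pi * Complex.I) := by
    push_cast
    ring
  rw [this, Complex.exp_add, Complex.exp_int_mul_two_pi_mul_I, mul_one]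

theorem mask_intCast {n : ℕ} (hn : n ≠ 0) {A : Finset ℕ} (hA : A.card = n) (k : ℤ) :
    mask n A k = 1 := by
  have h := mask_add_intCast n A 0 k
  rw [zero_add] at h
  rw [h]
  simp [mask, hA, hn]

/-- Up to a constant, the mask is the polynomial `∑ X^a` at `exp (-2πi t)`, and `t ↦ exp (-2πi t)`
is injective on `[0, 1)`. -/
theorem finite_mask_roots {n : ℕ} (hn : n ≠ 0) {A : Finset ℕ} (h0 : 0 ∈ A) :
    {t : ℝ | t ∈ Set.Ico 0 1 ∧ mask n A t = 0}.Finite := by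
  set p : Polynomial ℂ := ∑ a ∈ A, Polynomial.X ^ a with hp
  have hp0 : p ≠ 0 := by
    intro h
    have : p.coeff 0 = 1 := by
      simp [hp, Polynomial.finsetSum_coeff, Polynomial.coeff_X_pow, h0]
    simp [h] at this
  set e : ℝ → ℂ := fun t ↦ Complex.exp (-2 * Real.pi * Complex.I * (t : ℂ)) with he
  refine Set.Finite.of_finite_image (f := e) ((p.roots.toFinset.finite_toSet).subset ?_) ?_
  · rintro _ ⟨t, ⟨-, ht⟩, rfl⟩
    have ht' : ∑ a ∈ A, Complex.exp (-2 * Real.pi * Complex.I * (a : ℂ) * (t : ℂ)) = 0 := by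
      simpa [mask, hn] using ht
    rw [Finset.mem_coe, Multiset.mem_toFinset, Polynomial.mem_roots hp0, Polynomial.IsRoot.def, hp]
    simp only [Polynomial.eval_finsetSum, Polynomial.eval_pow, Polynomial.eval_X]
    rw [← ht']
    refine Finset.sum_congr rfl fun a _ ↦ ?_
    rw [he, ← Complex.exp_nat_mul]
    congr 1
    ring
  · rintro s ⟨hs, -⟩ t ⟨ht, -⟩ hst
    obtain ⟨k, hk⟩ := Complex.exp_eq_exp_iff_exists_int.1 hst
    have h2 : (s : ℂ) = t - k := by
      have h3 : (2 * Real.pi * Complex.I : ℂ) ≠ 0 := Complex.two_pi_I_ne_zero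
      have : (2 * Real.pi * Complex.I : ℂ) * s = 2 * Real.pi * Complex.I * (t - k) := by
        linear_combination -hk
      exact mul_left_cancel₀ h3 this
    have h4 : s = t - k := by exact_mod_cast h2
    have h5 : (-1 : ℝ) < (k : ℝ) := by linarith [hs.2, ht.1]
    have h6 : (k : ℝ) < 1 := by linarith [hs.1, ht.2]
    have h7 : -1 < k := by exact_mod_cast h5
    have h8 : k < 1 := by exact_mod_cast h6
    have : k = 0 := by omega
    rw [h4, this]
    simp

/-- The roots of the mask lie on finitely many levels of the `n`-ary tree. -/
theorem exists_level_bound {n : ℕ} (hn : 2 ≤ n) {A : Finset ℕ} (h0 : 0 ∈ A) :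
    ∃ N : ℕ, ∀ j m : ℕ, ¬ n ∣ m → m < n ^ j → mask n A ((m : ℝ) / n ^ j) = 0 → j ≤ N := by
  have hn0 : (n : ℝ) ≠ 0 := by positivity
  have hfin : {j : ℕ | ∃ m : ℕ, ¬ n ∣ m ∧ m < n ^ j ∧ mask n A ((m : ℝ) / n ^ j) = 0}.Finite := by
    refine ((finite_mask_roots (two_pos.trans_le hn).ne' h0).biUnion
      (t := fun r ↦ {j : ℕ | ∃ m : ℕ, ¬ n ∣ m ∧ (m : ℝ) / n ^ j = r}) fun r _ ↦ ?_).subset ?_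
    -- A fraction `m / n^j` with `n ∤ m` determines `j`, so each root lies on at most one level.
    · have key : ∀ i j m m' : ℕ, ¬ n ∣ m' → (m : ℝ) / n ^ i = m' / n ^ j → j ≤ i := by
        intro i j m m' hm' h
        by_contra! hij
        obtain ⟨d, rfl⟩ := Nat.exists_eq_add_of_lt hij
        have : (m' : ℝ) = n ^ (d + 1) * m := by
          rw [add_assoc, pow_add] at h
          field_simp at h
          linarith
        have : m' = n ^ (d + 1) * m := by exact_mod_cast this
        exact hm' (this ▸ Dvd.dvd.mul_right (dvd_pow_self n d.succ_ne_zero) m)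
      refine Set.Subsingleton.finite ?_
      rintro i ⟨m, hm, rfl⟩ j ⟨m', hm', h⟩
      exact le_antisymm (key j i m' m hm h) (key i j m m' hm' h.symm)
    · rintro j ⟨m, hm, hlt, h⟩
      refine Set.mem_biUnion (x := (m : ℝ) / n ^ j) ⟨⟨by positivity, ?_⟩, h⟩ ⟨m, hm, rfl⟩
      rw [div_lt_one (by positivity)]
      exact_mod_cast hlt
  obtain ⟨N, hN⟩ := hfin.bddAbove
  exact ⟨N, fun j m hm hlt h ↦ hN ⟨m, hm, hlt, h⟩⟩

/-! ### Paths and cut sets -/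

theorem IsPath.mem_treeVertices {n : ℕ} {v : ℕ → ℝ} (hv : IsPath n v) (j : ℕ) :
    v j ∈ treeVertices n := by
  induction j with
  | zero => rw [hv.1]; exact Relation.ReflTransGen.refl
  | succ j ih => exact Relation.ReflTransGen.tail ih (hv.2 j)

theorem IsPath.exists_eq_div {n : ℕ} (hn : 2 ≤ n) {v : ℕ → ℝ} (hv : IsPath n v) (j : ℕ) :
    ∃ m : ℕ, ¬ n ∣ m ∧ m < n ^ (j + 1) ∧ v (j + 1) = m / n ^ (j + 1) := by
  have hn0 : (n : ℝ) ≠ 0 := by positivity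
  induction j with
  | zero =>
    rcases hv.2 0 with ⟨-, k, hk1, hkn, hk⟩ | ⟨h, -⟩
    · exact ⟨k, Nat.not_dvd_of_pos_of_lt hk1 hkn, by simpa using hkn, by simpa using hk⟩
    · exact absurd hv.1 h
  | succ j ih =>
    obtain ⟨m, hm, hlt, hvm⟩ := ih
    have hm0 : m ≠ 0 := by rintro rfl; exact hm (dvd_zero n)
    rcases hv.2 (j + 1) with ⟨h, -⟩ | ⟨-, k, hkn, hk⟩
    · rw [hvm, div_eq_zero_iff] at h
      rcases h with h | h
      · exact absurd (by exact_mod_cast h) hm0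
      · exact absurd h (pow_ne_zero _ hn0)
    · refine ⟨m + n ^ (j + 1) * k, ?_, ?_, ?_⟩
      · rwa [Nat.dvd_add_left (Dvd.dvd.mul_right (dvd_pow_self n j.succ_ne_zero) k)]
      · calc m + n ^ (j + 1) * k < n ^ (j + 1) + n ^ (j + 1) * k := by omega
          _ = n ^ (j + 1) * (k + 1) := by ring
          _ ≤ n ^ (j + 1) * n := by gcongr; omega
          _ = n ^ (j + 1 + 1) := by ring
      · rw [hk, hvm]
        push_cast
        rw [pow_succ (n : ℝ) (j + 1)]
        field_simp

/-- Moving to the parent is multiplication by `n` modulo 1, so the periodic mask at an ancestor can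
be read off from any descendant. -/
theorem IsPath.exists_pow_mul_eq {n : ℕ} (hn : n ≠ 0) {v : ℕ → ℝ} (hv : IsPath n v) (i j : ℕ) :
    ∃ k : ℤ, (n : ℝ) ^ i * v (j + i) = v j + k := by
  have hn0 : (n : ℝ) ≠ 0 := by exact_mod_cast hn
  induction i with
  | zero => exact ⟨0, by simp⟩
  | succ i ih =>
    obtain ⟨k, hk⟩ := ih
    obtain ⟨l, hl⟩ : ∃ l : ℕ, n * v (j + i + 1) = v (j + i) + l := by
      rcases hv.2 (j + i) with ⟨h, l, -, -, hl⟩ | ⟨-, l, -, hl⟩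
      · exact ⟨l, by rw [h, hl]; field_simp; simp⟩
      · exact ⟨l, by rw [hl]; field_simp⟩
    refine ⟨k + n ^ i * l, ?_⟩
    rw [← add_assoc, pow_succ, mul_assoc, hl, mul_add, hk]
    push_cast
    ring

theorem IsPath.mask_pow_mul {n : ℕ} (hn : n ≠ 0) {v : ℕ → ℝ} (hv : IsPath n v) (A : Finset ℕ)
    (i j : ℕ) : mask n A (n ^ i * v (j + i)) = mask n A (v j) := by
  obtain ⟨k, hk⟩ := hv.exists_pow_mul_eq hn i j
  rw [hk, mask_add_intCast]

/-- If every path contains a root of the mask, the first roots on the paths form a minimal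
cut set. -/
theorem exists_isMinimalCutSet {n : ℕ} (hn : n ≠ 0) {A : Finset ℕ} (hA : A.card = n)
    (h : ∀ v, IsPath n v → ∃ j, mask n A (v (j + 1)) = 0) :
    ∃ C : Set ℝ, IsMinimalCutSet n C ∧ ∀ α ∈ C, mask n A α = 0 := by
  classical
  -- Modulo 1 the points `n^(i+1) x` are the ancestors of `x`, then integers, where the mask is 1.
  -- The last condition thus excludes roots with a root above them.
  refine ⟨{x | x ∈ treeVertices n ∧ mask n A x = 0 ∧ ∀ i, mask n A (n ^ (i + 1) * x) ≠ 0},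
    ⟨fun x hx ↦ hx.1, fun v hv ↦ ?_⟩, fun x hx ↦ hx.2.1⟩
  set j₀ := Nat.find (h v hv) with hj₀
  have hroot : mask n A (v (j₀ + 1)) = 0 := Nat.find_spec (h v hv)
  refine ⟨v (j₀ + 1), ⟨⟨hv.mem_treeVertices _, hroot, fun i ↦ ?_⟩, j₀, rfl⟩, ?_⟩
  · rcases lt_or_ge i j₀ with hi | hi
    · obtain ⟨d, hd⟩ := Nat.exists_eq_add_of_lt hi
      have := hv.mask_pow_mul hn A (i + 1) (d + 1)
      rw [show d + 1 + (i + 1) = j₀ + 1 by omega] at this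
      rw [this]
      exact Nat.find_min (h v hv) (by omega)
    · obtain ⟨d, rfl⟩ := Nat.exists_eq_add_of_le hi
      obtain ⟨k, hk⟩ := hv.exists_pow_mul_eq hn (j₀ + 1) 0
      rw [zero_add, hv.1, zero_add] at hk
      rw [show j₀ + d + 1 = d + (j₀ + 1) by omega, pow_add, mul_assoc, hk]
      have := mask_intCast hn hA (n ^ d * k)
      push_cast at this
      rw [this]
      exact one_ne_zero
  · rintro _ ⟨⟨-, hy, hyC⟩, i, rfl⟩
    rcases (Nat.find_min' (h v hv) hy).eq_or_lt with he | hlt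
    · rw [hj₀, he]
    · obtain ⟨d, hd⟩ := Nat.exists_eq_add_of_lt hlt
      refine absurd ?_ (hyC d)
      have := hv.mask_pow_mul hn A (d + 1) (j₀ + 1)
      rw [show j₀ + 1 + (d + 1) = i + 1 by omega] at this
      rw [this, hroot]

/-- The path of an integer `k` not divisible by `n` consists of the fractional parts of
`k / n ^ j`. -/
theorem isPath_emod_div {n : ℕ} (hn : 2 ≤ n) {k : ℤ} (hk : ¬ (n : ℤ) ∣ k) :
    IsPath n fun j ↦ ((k % (n : ℤ) ^ j : ℤ) : ℝ) / n ^ j := by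
  have hn0 : (n : ℝ) ≠ 0 := by positivity
  have hnZ : (0 : ℤ) < n := by omega
  -- `d` is the base-`n` digit of `k` at place `j`; the Euclidean remainder also covers negative
  -- `k`.
  have hstep : ∀ j, ∃ d : ℕ, d < n ∧
      k % (n : ℤ) ^ (j + 1) = k % (n : ℤ) ^ j + (n : ℤ) ^ j * d := by
    intro j
    have hd0 : 0 ≤ k / (n : ℤ) ^ j % n := Int.emod_nonneg _ hnZ.ne'
    obtain ⟨d, hd⟩ := Int.eq_ofNat_of_zero_le hd0
    refine ⟨d, ?_, ?_⟩
    · have := Int.emod_lt_of_pos (k / (n : ℤ) ^ j) hnZ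
      omega
    · have hpos : (0 : ℤ) < (n : ℤ) ^ j := by positivity
      have e1 := Int.emod_add_mul_ediv k ((n : ℤ) ^ j)
      have e2 := Int.emod_add_mul_ediv k ((n : ℤ) ^ (j + 1))
      have e3 := Int.emod_add_mul_ediv (k / (n : ℤ) ^ j) n
      have e4 : k / (n : ℤ) ^ (j + 1) = k / (n : ℤ) ^ j / n := by
        rw [pow_succ, Int.ediv_ediv_of_nonneg hpos.le]
      rw [e4, pow_succ] at e2
      rw [hd] at e3
      rw [pow_succ]
      linear_combination e2 - e1 - (n : ℤ) ^ j * e3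
  refine ⟨by simp, fun j ↦ ?_⟩
  obtain ⟨d, hdn, hd⟩ := hstep j
  rcases Nat.eq_zero_or_pos j with rfl | hj
  · refine Or.inl ⟨by simp, d, ?_, hdn, ?_⟩
    · by_contra! h0
      refine hk (Int.dvd_of_emod_eq_zero ?_)
      have hd0 : d = 0 := by omega
      simpa [hd0] using hd
    · simp only [hd]
      simp
  · refine Or.inr ⟨?_, d, hdn, ?_⟩
    · refine div_ne_zero ?_ (pow_ne_zero _ hn0)
      rw [Int.cast_ne_zero]
      exact fun h ↦ hk ((dvd_pow_self _ hj.ne').trans (Int.dvd_of_emod_eq_zero h))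
    · simp only [hd]
      push_cast
      rw [pow_succ]
      field_simp

/-- Powers of `n` dividing `k` only delay the root by `s` levels; the cofactor `k'` has a genuine
path. -/
theorem exists_mask_div_eq_zero {n : ℕ} (hn : 2 ≤ n) {A : Finset ℕ}
    (h : ∀ v, IsPath n v → ∃ j, mask n A (v (j + 1)) = 0) {k : ℤ} (hk : k ≠ 0) :
    ∃ j : ℕ, mask n A (k / n ^ (j + 1)) = 0 := by
  have hn0 : (n : ℝ) ≠ 0 := by positivity
  obtain ⟨s, k', hk', rfl⟩ : ∃ (s : ℕ) (k' : ℤ), ¬ (n : ℤ) ∣ k' ∧ k = n ^ s * k' := by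
    have hf : FiniteMultiplicity (n : ℤ) k :=
      Int.finiteMultiplicity_iff.2 ⟨by simp; omega, hk⟩
    obtain ⟨c, hc, hd⟩ := hf.exists_eq_pow_mul_and_not_dvd
    exact ⟨_, c, hd, hc⟩
  obtain ⟨j, hj⟩ := h _ (isPath_emod_div hn hk')
  refine ⟨s + j, ?_⟩
  rw [← hj]
  have e : (((n : ℤ) ^ s * k' : ℤ) : ℝ) / n ^ (s + j + 1) =
      ((k' % (n : ℤ) ^ (j + 1) : ℤ) : ℝ) / n ^ (j + 1) +
        ((k' / (n : ℤ) ^ (j + 1) : ℤ) : ℝ) := by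
    have := congrArg (Int.cast : ℤ → ℝ) (Int.emod_add_mul_ediv k' ((n : ℤ) ^ (j + 1)))
    push_cast at this
    push_cast
    rw [add_assoc, pow_add]
    field_simp
    linarith
  rw [e, mask_add_intCast]

/-! ### The Fourier transform of the self-similar measure -/

/-- The Fourier transform `t ↦ ∫ exp (-2πi t x) dμ(x)` of a measure. -/
def fourierMeasure (μ : Measure ℝ) (t : ℝ) : ℂ := charFun μ (-(2 * Real.pi * t))

theorem fourierMeasure_eq_integral (μ : Measure ℝ) (t : ℝ) :
    fourierMeasure μ t = ∫ x : ℝ, Complex.exp (-2 * Real.pi * Complex.I * t * x) ∂μ := by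
  rw [fourierMeasure, charFun_apply_real]
  congr 1
  ext x
  push_cast
  congr 1
  ring

theorem IsSelfSimilar.fourierMeasure_eq {n : ℕ} {A : Finset ℕ} {μ : Measure ℝ}
    [IsProbabilityMeasure μ] (h : IsSelfSimilar n A μ) (t : ℝ) :
    fourierMeasure μ t = mask n A (t / n) * fourierMeasure μ (t / n) := by
  have hnorm : ∀ s x : ℝ, ‖Complex.exp (-2 * Real.pi * Complex.I * s * x)‖ ≤ 1 := by
    intro s x
    rw [show (-2 * Real.pi * Complex.I * s * x : ℂ) = ((-2 * Real.pi * s * x : ℝ) : ℂ) * Complex.I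
      by push_cast; ring, Complex.norm_exp_ofReal_mul_I]
  rw [fourierMeasure_eq_integral, fourierMeasure_eq_integral,
    h.integral_eq (by fun_prop) (hnorm t), mask, one_div, mul_assoc (n : ℂ)⁻¹, Finset.sum_mul]
  congr 1
  refine Finset.sum_congr rfl fun a _ ↦ ?_
  rw [← integral_const_mul]
  congr 1
  ext x
  rw [← Complex.exp_add]
  congr 1
  push_cast
  ring

theorem IsSelfSimilar.fourierMeasure_eq_prod {n : ℕ} {A : Finset ℕ} {μ : Measure ℝ}
    [IsProbabilityMeasure μ] (h : IsSelfSimilar n A μ) (t : ℝ) (m : ℕ) :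
    fourierMeasure μ t =
      (∏ j ∈ Finset.range m, mask n A (t / n ^ (j + 1))) * fourierMeasure μ (t / n ^ m) := by
  induction m with
  | zero => simp
  | succ m ih =>
    rw [ih, h.fourierMeasure_eq (t / n ^ m), Finset.prod_range_succ, div_div, ← pow_succ]
    ring

theorem IsSelfSimilar.fourierMeasure_eq_zero {n : ℕ} {A : Finset ℕ} {μ : Measure ℝ}
    [IsProbabilityMeasure μ] (h : IsSelfSimilar n A μ) {t : ℝ} {j : ℕ}
    (ht : mask n A (t / n ^ (j + 1)) = 0) : fourierMeasure μ t = 0 := by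
  rw [h.fourierMeasure_eq_prod t (j + 1), Finset.prod_eq_zero (Finset.self_mem_range_succ j) ht,
    zero_mul]

/-- The remaining factor at `t / n^m` tends to 1, so for some `m` the zero must come from the finite
product. -/
theorem IsSelfSimilar.exists_mask_eq_zero {n : ℕ} (hn : 2 ≤ n) {A : Finset ℕ} {μ : Measure ℝ}
    [IsProbabilityMeasure μ] (h : IsSelfSimilar n A μ) {t : ℝ} (ht : fourierMeasure μ t = 0) :
    ∃ j : ℕ, mask n A (t / n ^ (j + 1)) = 0 := by
  have hn1 : (1 : ℝ) < n := by exact_mod_cast hn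
  have hcont : Continuous (fourierMeasure μ) := continuous_charFun.comp (by fun_prop)
  have h1 : fourierMeasure μ 0 = 1 := by simp [fourierMeasure]
  have hlim : Filter.Tendsto (fun m : ℕ ↦ fourierMeasure μ (t / n ^ m)) Filter.atTop (𝓝 1) := by
    rw [← h1]
    refine (hcont.tendsto 0).comp ?_
    exact tendsto_const_nhds.div_atTop (tendsto_pow_atTop_atTop_of_one_lt hn1)
  obtain ⟨m, hm⟩ := (hlim.eventually_ne one_ne_zero).exists
  rw [h.fourierMeasure_eq_prod t m, mul_eq_zero, or_iff_left hm, Finset.prod_eq_zero_iff] at ht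
  obtain ⟨j, -, hj⟩ := ht
  exact ⟨j, hj⟩

/-! ### Integrability implies the existence of a cut set -/

/-- Riemann–Lebesgue for `χ f`, where the cutoff `χ` makes the exponential an admissible test
function. -/
theorem MemL1.tendsto_fourierMeasure {φ : 𝓢'(ℝ, ℂ)} (h : MemL1 φ) {μ : Measure ℝ}
    (hφ : ∀ g : 𝓢(ℝ, ℂ), φ g = ∫ x, g x ∂μ) {T : Set ℝ} (hT : IsCompact T) (hμT : μ Tᶜ = 0) :
    Filter.Tendsto (fourierMeasure μ) (Filter.cocompact ℝ) (𝓝 0) := by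
  obtain ⟨f, hf⟩ := h
  obtain ⟨χ, hχc, hχ1, -, -⟩ := exists_schwartzMap_eq_one_nhdsSet hT isOpen_univ
    (Set.subset_univ T)
  refine (Real.tendsto_integral_exp_smul_cocompact fun x ↦ χ x * f x).congr fun t ↦ ?_
  have hc : HasCompactSupport fun x : ℝ ↦
      χ x * Complex.exp (-2 * Real.pi * Complex.I * t * x) := hχc.mul_right
  have hd : ContDiff ℝ (⊤ : ℕ∞) fun x : ℝ ↦
      χ x * Complex.exp (-2 * Real.pi * Complex.I * t * x) :=
    (χ.smooth _).mul (contDiff_const.mul Complex.ofRealCLM.contDiff).cexp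
  have he : fourierMeasure μ t = φ (hc.toSchwartzMap hd) := by
    rw [fourierMeasure_eq_integral, hφ]
    refine integral_congr_ae ?_
    filter_upwards [show ∀ᵐ x ∂μ, x ∈ T from hμT] with x hx
    simp [hχ1.self_of_nhdsSet x hx]
  rw [he, ← hf, Lp.toTemperedDistribution_apply]
  congr 1
  ext x
  rw [Circle.smul_def, Real.fourierChar_apply]
  simp only [HasCompactSupport.toSchwartzMap_toFun, smul_eq_mul]
  have : (((2 * Real.pi * -(x * t) : ℝ) : ℂ) * Complex.I) =
      -2 * Real.pi * Complex.I * t * x := by push_cast; ring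
  rw [this]
  ring

/-- The transform is constant along `n^m k`, which tends to infinity. -/
theorem IsSelfSimilar.fourierMeasure_natCast_eq_zero {n : ℕ} (hn : 2 ≤ n) {A : Finset ℕ}
    (hA : A.card = n) {μ : Measure ℝ} [IsProbabilityMeasure μ] (h : IsSelfSimilar n A μ)
    (hlim : Filter.Tendsto (fourierMeasure μ) (Filter.cocompact ℝ) (𝓝 0)) {k : ℕ} (hk : k ≠ 0) :
    fourierMeasure μ k = 0 := by
  have hn1 : (1 : ℝ) < n := by exact_mod_cast hn
  have hn0 : (n : ℝ) ≠ 0 := by positivity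
  have hconst : ∀ m : ℕ, fourierMeasure μ (n ^ m * k) = fourierMeasure μ k := by
    intro m
    induction m with
    | zero => simp
    | succ m ih =>
      rw [h.fourierMeasure_eq, ← ih,
        show (n : ℝ) ^ (m + 1) * k / n = ((n ^ m * k : ℤ) : ℝ) by
          push_cast; rw [pow_succ]; field_simp,
        mask_intCast (by omega) hA, one_mul]
      push_cast
      rfl
  have hseq : Filter.Tendsto (fun m : ℕ ↦ (n : ℝ) ^ m * k) Filter.atTop (Filter.cocompact ℝ) := by
    refine Filter.Tendsto.mono_right ?_ atTop_le_cocompact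
    exact (tendsto_pow_atTop_atTop_of_one_lt hn1).atTop_mul_const (by positivity)
  have := hlim.comp hseq
  simp only [Function.comp_def, hconst] at this
  exact tendsto_nhds_unique tendsto_const_nhds this

theorem IsPath.exists_mask_eq_zero {n : ℕ} (hn : 2 ≤ n) {A : Finset ℕ} (h0 : 0 ∈ A)
    (h : ∀ k : ℕ, k ≠ 0 → ∃ j : ℕ, mask n A (k / n ^ (j + 1)) = 0) {v : ℕ → ℝ}
    (hv : IsPath n v) : ∃ j, mask n A (v (j + 1)) = 0 := by
  have hn0 : (n : ℝ) ≠ 0 := by positivity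
  obtain ⟨N, hN⟩ := exists_level_bound hn h0
  -- Level `N + 1` lies below every possible root. The root `m / n^(j+1)` provided for this
  -- numerator thus has `j ≤ N`, so modulo 1 it is the earlier vertex `v (j + 1)`.
  obtain ⟨m, hm, hlt, hvm⟩ := hv.exists_eq_div hn N
  obtain ⟨j, hj⟩ := h m (by rintro rfl; exact hm (dvd_zero n))
  have hjN : j ≤ N := by
    by_contra! hjN
    have := hN (j + 1) m hm (hlt.trans_le (Nat.pow_le_pow_right (by omega) (by omega))) hj
    omega
  obtain ⟨d, rfl⟩ := Nat.exists_eq_add_of_le hjN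
  refine ⟨j, ?_⟩
  rw [← hj, ← hv.mask_pow_mul (by omega) A d (j + 1), show j + 1 + d = j + d + 1 by omega, hvm]
  congr 1
  rw [show j + d + 1 = d + (j + 1) by omega, pow_add]
  field_simp

/-! ### A cut set of roots implies absolute continuity -/

/-- The Fourier coefficients agree, and trigonometric polynomials are dense in the continuous
functions on the circle. -/
theorem map_coe_addCircle_eq_haar {μ : Measure ℝ} [IsProbabilityMeasure μ]
    (h : ∀ k : ℤ, k ≠ 0 → fourierMeasure μ k = 0) :
    μ.map ((↑) : ℝ → AddCircle (1 : ℝ)) = AddCircle.haarAddCircle := by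
  have hm : Measurable ((↑) : ℝ → AddCircle (1 : ℝ)) := (AddCircle.continuous_mk' 1).measurable
  have : IsProbabilityMeasure (μ.map ((↑) : ℝ → AddCircle (1 : ℝ))) :=
    Measure.isProbabilityMeasure_map hm.aemeasurable
  set Q := μ.map ((↑) : ℝ → AddCircle (1 : ℝ))
  have hbasis : ∀ k : ℤ, ∫ x, fourier k x ∂Q =
      ∫ x, fourier k x ∂(AddCircle.haarAddCircle (T := (1 : ℝ))) := by
    intro k
    have h1 : ∫ x, fourier k x ∂(AddCircle.haarAddCircle (T := (1 : ℝ))) =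
        (Pi.single k 1 : ℤ → ℂ) 0 := by
      rw [← fourierCoeff_fourier (T := (1 : ℝ)) k]
      simp [fourierCoeff]
    have h2 : ∫ x, fourier k x ∂Q = fourierMeasure μ ((-k : ℤ) : ℝ) := by
      rw [fourierMeasure_eq_integral,
        integral_map hm.aemeasurable (fourier k).continuous.aestronglyMeasurable]
      congr 1
      ext x
      rw [fourier_coe_apply]
      congr 1
      push_cast
      ring
    rw [h1, h2]
    rcases eq_or_ne k 0 with rfl | hk
    · simp [fourierMeasure]
    · rw [h _ (neg_ne_zero.2 hk), Pi.single_eq_of_ne hk.symm]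
  have hcont : ∀ P : Measure (AddCircle (1 : ℝ)), IsProbabilityMeasure P →
      Continuous fun f : C(AddCircle (1 : ℝ), ℂ) ↦ ∫ x, f x ∂P := by
    intro P _
    refine LipschitzWith.continuous (K := 1) (LipschitzWith.of_dist_le_mul fun f g ↦ ?_)
    have hint : ∀ f : C(AddCircle (1 : ℝ), ℂ), Integrable f P := fun f ↦
      f.continuous.integrable_of_hasCompactSupport (HasCompactSupport.of_compactSpace f)
    rw [dist_eq_norm, ← integral_sub (hint f) (hint g), NNReal.coe_one, one_mul, dist_eq_norm]
    refine (norm_integral_le_of_norm_le_const (C := ‖f - g‖)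
      (.of_forall fun x ↦ (f - g).norm_coe_le_norm x)).trans (by simp)
  have hall : ∀ f : C(AddCircle (1 : ℝ), ℂ),
      ∫ x, f x ∂Q = ∫ x, f x ∂(AddCircle.haarAddCircle (T := (1 : ℝ))) := by
    have hint : ∀ (P : Measure (AddCircle (1 : ℝ))) [IsProbabilityMeasure P]
        (f : C(AddCircle (1 : ℝ), ℂ)), Integrable f P := fun P _ f ↦
      f.continuous.integrable_of_hasCompactSupport (HasCompactSupport.of_compactSpace f)
    intro f
    have hf : f ∈ (Submodule.span ℂ (Set.range (fourier (T := (1 : ℝ))))).topologicalClosure := by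
      rw [span_fourier_closure_eq_top]
      trivial
    refine closure_minimal (s := (Submodule.span ℂ (Set.range (fourier (T := (1 : ℝ)))) :
      Set C(AddCircle (1 : ℝ), ℂ))) (t := {f | ∫ x, f x ∂Q =
        ∫ x, f x ∂(AddCircle.haarAddCircle (T := (1 : ℝ)))}) ?_
      (isClosed_eq (hcont _ inferInstance) (hcont _ inferInstance)) hf
    intro g hg
    induction hg using Submodule.span_induction with
    | mem g hg => obtain ⟨k, rfl⟩ := hg; exact hbasis k
    | zero => simp
    | add g g' _ _ hg hg' =>
      have hg : ∫ x, g x ∂Q = ∫ x, g x ∂AddCircle.haarAddCircle := hg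
      have hg' : ∫ x, g' x ∂Q = ∫ x, g' x ∂AddCircle.haarAddCircle := hg'
      change ∫ x, (g x + g' x) ∂Q = ∫ x, (g x + g' x) ∂AddCircle.haarAddCircle
      rw [integral_add (hint _ _) (hint _ _), integral_add (hint _ _) (hint _ _), hg, hg']
    | smul c g _ hg =>
      have hg : ∫ x, g x ∂Q = ∫ x, g x ∂AddCircle.haarAddCircle := hg
      change ∫ x, c * g x ∂Q = ∫ x, c * g x ∂AddCircle.haarAddCircle
      rw [integral_const_mul, integral_const_mul, hg]
  refine ext_of_forall_integral_eq_of_IsFiniteMeasure fun f ↦ ?_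
  have := hall ⟨fun x ↦ (f x : ℂ), by fun_prop⟩
  simp only [ContinuousMap.coe_mk, integral_complex_ofReal] at this
  exact_mod_cast this

/-- A null set has a null union of integer translates, hence a null image in the circle; the
preimage of that image contains it. -/
theorem absolutelyContinuous_of_map_coe_addCircle {μ : Measure ℝ}
    (h : μ.map ((↑) : ℝ → AddCircle (1 : ℝ)) = AddCircle.haarAddCircle) : μ ≪ volume := by
  have hm : Measurable ((↑) : ℝ → AddCircle (1 : ℝ)) := (AddCircle.continuous_mk' 1).measurable
  refine Measure.AbsolutelyContinuous.mk fun E hE hE0 ↦ ?_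
  set π : ℝ → AddCircle (1 : ℝ) := (↑) with hπ
  set F : Set ℝ := ⋃ k : ℤ, (fun x : ℝ ↦ x + k) ⁻¹' E with hF
  have hFm : MeasurableSet F := .iUnion fun k ↦ measurable_add_const _ hE
  have hF0 : volume F = 0 := measure_iUnion_null fun k ↦ by
    rw [measure_preimage_add_right, hE0]
  have hinj : Set.InjOn π (F ∩ Set.Ioc 0 (0 + 1)) := by
    intro x hx y hy hxy
    exact (AddCircle.coe_eq_coe_iff_of_mem_Ioc hx.2 hy.2).1 hxy
  -- Restricting to a fundamental domain makes `π` injective, so the image of a Borel set is Borel.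
  have hGm : MeasurableSet (π '' (F ∩ Set.Ioc 0 (0 + 1))) :=
    (hFm.inter measurableSet_Ioc).image_of_measurable_injOn hm hinj
  have hG0 : volume (π '' (F ∩ Set.Ioc 0 (0 + 1))) = 0 := by
    rw [← (AddCircle.measurePreserving_mk 1 0).measure_preimage hGm.nullMeasurableSet]
    refine measure_mono_null ?_ (Measure.absolutelyContinuous_of_le Measure.restrict_le_self hF0)
    rintro x ⟨y, ⟨hyF, -⟩, hyx⟩
    obtain ⟨k, hk⟩ := Set.mem_iUnion.1 hyF
    obtain ⟨l, hl⟩ := AddSubgroup.mem_zmultiples_iff.1 (QuotientAddGroup.eq_iff_sub_mem.1 hyx)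
    refine Set.mem_iUnion.2 ⟨k + l, ?_⟩
    simp only [zsmul_eq_mul, mul_one] at hl
    have : x + ((k + l : ℤ) : ℝ) = y + k := by
      push_cast
      linarith
    rwa [Set.mem_preimage, this]
  have hEG : E ⊆ π ⁻¹' (π '' (F ∩ Set.Ioc 0 (0 + 1))) := by
    intro x hx
    obtain ⟨y, hy, hyx⟩ := (AddCircle.coe_image_Ioc_eq 1 0).ge (Set.mem_univ (x : AddCircle (1 : ℝ)))
    refine ⟨y, ⟨?_, hy⟩, hyx⟩
    obtain ⟨l, hl⟩ := AddSubgroup.mem_zmultiples_iff.1 (QuotientAddGroup.eq_iff_sub_mem.1 hyx)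
    refine Set.mem_iUnion.2 ⟨-l, ?_⟩
    simp only [zsmul_eq_mul, mul_one] at hl
    rwa [Set.mem_preimage, show y + ((-l : ℤ) : ℝ) = x by push_cast; linarith]
  refine measure_mono_null hEG ?_
  rw [← Measure.map_apply hm hGm, h]
  rwa [AddCircle.volume_eq_smul_haarAddCircle, ENNReal.ofReal_one, one_smul] at hG0

end

end NumberSystem

end

theorem theorem3p2 (n : ℕ) (hn : 2 ≤ n) (A : Finset ℕ) (hA : A.card = n) (h0 : 0 ∈ A) :
    (∃! φ : TemperedDistribution ℝ ℂ, NumberSystem.IsRefinable n (two_pos.trans_le hn).ne' A φ) ∧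
    ∀ φ : TemperedDistribution ℝ ℂ, NumberSystem.IsRefinable n (two_pos.trans_le hn).ne' A φ →
      List.TFAE [
        NumberSystem.HasUniqueExpansions n A,
        NumberSystem.MemL1 φ,
        ∃ C : Set ℝ, NumberSystem.IsMinimalCutSet n C ∧
          ∀ α ∈ C, NumberSystem.mask n A α = 0] := by
  obtain ⟨μ, T, hμ, hT, hμT, hTA, h⟩ := NumberSystem.exists_isSelfSimilar hn hA
  have hn' : n ≠ 0 := (two_pos.trans_le hn).ne'
  refine ⟨⟨μ.toTemperedDistribution, h.isRefinable hn' hT hμT, fun φ hφ ↦ ?_⟩, fun φ hφ ↦ ?_⟩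
  · ext g
    exact hφ.apply_eq_integral hn hA h hT hμT g
  have hφμ := hφ.apply_eq_integral hn hA h hT hμT
  tfae_have 1 → 2 := fun ha ↦ NumberSystem.memL1_of_absolutelyContinuous
    (Measure.absolutelyContinuous_of_le (NumberSystem.le_volume_of_forall_Ioc
      (h.measure_Ioc_le hn ha.hasInjectiveDigits))) hφμ
  tfae_have 2 → 1 := by
    intro hb
    by_contra ha
    exact hb.volume_ne_zero hφμ hT hμT
      (NumberSystem.volume_eq_zero_of_not_hasInjectiveDigits hn' hA
        (fun hinj ↦ ha (hinj.hasUniqueExpansions h0)) hT hTA)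
  tfae_have 2 → 3 := fun hb ↦ NumberSystem.exists_isMinimalCutSet hn' hA fun _ hv ↦
    hv.exists_mask_eq_zero hn h0 fun _ hk ↦ h.exists_mask_eq_zero hn
      (h.fourierMeasure_natCast_eq_zero hn hA (hb.tendsto_fourierMeasure hφμ hT hμT) hk)
  tfae_have 3 → 2 := by
    rintro ⟨C, hC, hroot⟩
    -- Only the existence of a common vertex is needed here, not its uniqueness.
    have hpath : ∀ v, NumberSystem.IsPath n v → ∃ j, NumberSystem.mask n A (v (j + 1)) = 0 := by
      intro v hv
      obtain ⟨x, ⟨hx, j, rfl⟩, -⟩ := hC.2 v hv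
      exact ⟨j, hroot _ hx⟩
    refine NumberSystem.memL1_of_absolutelyContinuous
      (NumberSystem.absolutelyContinuous_of_map_coe_addCircle
        (NumberSystem.map_coe_addCircle_eq_haar fun k hk ↦ ?_)) hφμ
    obtain ⟨j, hj⟩ := NumberSystem.exists_mask_div_eq_zero hn hpath hk
    exact h.fourierMeasure_eq_zero hj
  tfae_finish
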